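/- Let $n>2$, let $(M,g)$ be a smooth $n$-dimensional Lorentzian manifold of signature $(-,+,\dots,+)$ with Levi-Civita connection $\nabla$, and let $\Delta$ be a smooth $(n-1)$-dimensional (embedded or, more generally, immersed) submanifold of $M$ which is null: at every $x\in\Delta$ the pullback $q_{ab}$ of $g$ to $T_x\Delta$ is degenerate. Let $L_x\subset T_x\Delta$ denote the degeneracy subspace of $q$. For a smooth (local) null vector field $\ell$ on and tangent to $\Delta$, let $\nabla_a\ell_b$ be the pullback to $\Delta$ of $\nabla_\alpha\ell_\beta$, that is, the tensor $(X,Y)\mapsto g(\nabla_X\ell,Y)$ for $X,Y$ tangent to $\Delta$. The tensors $q_{ab}$ and $\nabla_a\ell_b$ descend to tensors on $T_x\Delta/L_x$, the first one to a positive definite metric; the expansion $\theta^{(\ell)}$ is the trace of the second one with respect to this metric. Assume that $\Delta$ is non-expanding: for every $x\in\Delta$ there is a null vector field $\ell$, defined on a neighbourhood of $x$ in $\Delta$, tangent to $\Delta$ and non-zero at $x$, with $\theta^{(\ell)}(x)=0$. Assume that at all points of $\Delta$ the Einstein equations $$R_{\alpha\beta}-\tfrac12 R\,g_{\alpha\beta}=-\Lambda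 g_{\alpha\beta}+T_{\alpha\beta}$$ hold, with a constant $\Lambda\in\mathbb{R}$ and a tensor field $T_{\alpha\beta}$ such that $T_{\alpha\beta}\ell^\alpha\ell^\beta\ge0$ for every null vector $\ell$ tangent to $\Delta$. (The sign convention of the Ricci tensor $R_{\alpha\beta}$ is the one in which round spheres have positive Ricci curvature.) Then: 1. $\Delta$ is shear-free: for every smooth null vector field $\ell$ defined on (an open subset of) $\Delta$ and tangent to $\Delta$, $\nabla_a\ell_b=0$; 2. the induced degenerate metric is Lie-dragged by every such $\ell$: $\mathcal{L}_\ell q_{ab}=0$; 3. $R_{\alpha\beta}\ell^\alpha\ell^\beta=0$ at every point of $\Delta$, for every null vector $\ell$ tangent to $\Delta$. -/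

import Mathlib

open Set Bundle Module
open scoped Manifold ContDiff

noncomputable section

/-! ### Riemannian tensor calculus in coordinates on `ℝⁿ`

`G u` is the matrix `(g_{ij})` of a metric in coordinates at the point with coordinates `u`. -/

/-- The partial derivative `∂ᵢ f` of a function of `n` real coordinates. -/
def partialDeriv {n : ℕ} (i : Fin n) (f : EuclideanSpace ℝ (Fin n) → ℝ)
    (u : EuclideanSpace ℝ (Fin n)) : ℝ :=
  fderiv ℝ f u (EuclideanSpace.single i 1)

/-- The Christoffel symbols
`Γᵏᵢⱼ = ½ ∑ₗ gᵏˡ (∂ᵢ g_{jl} + ∂ⱼ g_{il} - ∂ₗ g_{ij})`; `christoffel G k i j u = Γᵏᵢⱼ(u)`. -/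
def christoffel {n : ℕ} (G : EuclideanSpace ℝ (Fin n) → Matrix (Fin n) (Fin n) ℝ)
    (k i j : Fin n) (u : EuclideanSpace ℝ (Fin n)) : ℝ :=
  (1 / 2) * ∑ l, (G u)⁻¹ k l *
    (partialDeriv i (fun w => G w j l) u + partialDeriv j (fun w => G w i l) u
      - partialDeriv l (fun w => G w i j) u)

/-- The components of the Riemann tensor, `riemannCoord G k l i j = Rᵏ_{l i j}`, with the
convention `[∇ᵢ, ∇ⱼ] Xᵏ = Rᵏ_{l i j} Xˡ`. -/
def riemannCoord {n : ℕ} (G : EuclideanSpace ℝ (Fin n) → Matrix (Fin n) (Fin n) ℝ)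
    (k l i j : Fin n) (u : EuclideanSpace ℝ (Fin n)) : ℝ :=
  partialDeriv i (christoffel G k j l) u - partialDeriv j (christoffel G k i l) u
    + ∑ m, (christoffel G k i m u * christoffel G m j l u
      - christoffel G k j m u * christoffel G m i l u)

/-- The components `R_{lj} = Rᵏ_{l k j}` of the Ricci tensor. -/
def ricciCoord {n : ℕ} (G : EuclideanSpace ℝ (Fin n) → Matrix (Fin n) (Fin n) ℝ)
    (l j : Fin n) (u : EuclideanSpace ℝ (Fin n)) : ℝ :=
  ∑ k, riemannCoord G k l k j u

/-- The scalar curvature `R = g^{lj} R_{lj}`. -/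
def scalarCurvatureCoord {n : ℕ} (G : EuclideanSpace ℝ (Fin n) → Matrix (Fin n) (Fin n) ℝ)
    (u : EuclideanSpace ℝ (Fin n)) : ℝ :=
  ∑ l, ∑ j, (G u)⁻¹ l j * ricciCoord G l j u

/-! ### Coordinates on a manifold -/

section Coordinates

variable {n : ℕ} {M : Type*} [TopologicalSpace M] [ChartedSpace (EuclideanSpace ℝ (Fin n)) M]

/-- The components, in the preferred chart around `c`, of a tangent vector `v` at `x`
(for `x` in the domain of that chart). -/
def vecCoord (c x : M) (v : TangentSpace (𝓡 n) x) : EuclideanSpace ℝ (Fin n) :=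
  mfderiv (𝓡 n) 𝓘(ℝ, EuclideanSpace ℝ (Fin n)) (extChartAt (𝓡 n) c) x v

/-- The `i`-th coordinate vector `∂ᵢ` of the preferred chart around `c`, at the point with
coordinates `u`. -/
def coordVec (c : M) (u : EuclideanSpace ℝ (Fin n)) (i : Fin n) :
    TangentSpace (𝓡 n) ((extChartAt (𝓡 n) c).symm u) :=
  mfderiv 𝓘(ℝ, EuclideanSpace ℝ (Fin n)) (𝓡 n) (extChartAt (𝓡 n) c).symm u
    (EuclideanSpace.single i (1 : ℝ) : EuclideanSpace ℝ (Fin n))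

/-- The matrix of components `h(∂ᵢ, ∂ⱼ)` of a field `h` of bilinear forms in the preferred chart
around `c`, as a function of the coordinates. -/
def formCoord (h : ∀ x : M, TangentSpace (𝓡 n) x →L[ℝ] TangentSpace (𝓡 n) x →L[ℝ] ℝ) (c : M)
    (u : EuclideanSpace ℝ (Fin n)) : Matrix (Fin n) (Fin n) ℝ :=
  Matrix.of fun i j => h ((extChartAt (𝓡 n) c).symm u) (coordVec c u i) (coordVec c u j)

/-- The Lie derivative `(ℒ_ℓ h)(X, Y)` at `p` of a field `h` of bilinear forms along a vector
field `ℓ`, in coordinates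
`(ℒ_ℓ h)_{ab} = ℓᶜ ∂_c h_{ab} + h_{cb} ∂_a ℓᶜ + h_{ac} ∂_b ℓᶜ`. -/
def lieDerivForm (h : ∀ x : M, TangentSpace (𝓡 n) x →L[ℝ] TangentSpace (𝓡 n) x →L[ℝ] ℝ)
    (ℓ : ∀ x : M, TangentSpace (𝓡 n) x) (p : M) (X Y : TangentSpace (𝓡 n) p) : ℝ :=
  let u := extChartAt (𝓡 n) p p
  let H := formCoord h p
  let L : EuclideanSpace ℝ (Fin n) → EuclideanSpace ℝ (Fin n) := fun w =>
    vecCoord p ((extChartAt (𝓡 n) p).symm w) (ℓ ((extChartAt (𝓡 n) p).symm w))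
  ∑ a, ∑ b, (∑ c, (L u c * partialDeriv c (fun w => H w a b) u
      + H u c b * partialDeriv a (fun w => L w c) u
      + H u a c * partialDeriv b (fun w => L w c) u)) * vecCoord p p X a * vecCoord p p Y b

end Coordinates

/-! ### Lorentzian metrics -/

/-- A smooth metric of signature `(-, +, …, +)`: at every point there is a vector `t` with
`g(t, t) < 0` on whose orthogonal complement `g` is positive definite. -/
structure LorentzMetric (n : ℕ) (M : Type*) [TopologicalSpace M]
    [ChartedSpace (EuclideanSpace ℝ (Fin n)) M] [IsManifold (𝓡 n) ∞ M] where
  val (x : M) : TangentSpace (𝓡 n) x →L[ℝ] TangentSpace (𝓡 n) x →L[ℝ] ℝ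
  symm (x : M) (v w : TangentSpace (𝓡 n) x) : val x v w = val x w v
  lorentzian (x : M) : ∃ t : TangentSpace (𝓡 n) x, val x t t < 0 ∧
    ∀ v : TangentSpace (𝓡 n) x, val x t v = 0 → v ≠ 0 → 0 < val x v v
  contMDiff : ContMDiff (𝓡 n)
    ((𝓡 n).prod 𝓘(ℝ, EuclideanSpace ℝ (Fin n) →L[ℝ] EuclideanSpace ℝ (Fin n) →L[ℝ] ℝ)) ∞
    (fun x => TotalSpace.mk' (EuclideanSpace ℝ (Fin n) →L[ℝ] EuclideanSpace ℝ (Fin n) →L[ℝ] ℝ)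
      (E := fun x : M => TangentSpace (𝓡 n) x →L[ℝ] TangentSpace (𝓡 n) x →L[ℝ] ℝ) x (val x))

namespace LorentzMetric

section

variable {n : ℕ} {M : Type*} [TopologicalSpace M] [ChartedSpace (EuclideanSpace ℝ (Fin n)) M]
  [IsManifold (𝓡 n) ∞ M]

/-- The Ricci tensor `Ric_x(v, w)`. -/
def ricci (g : LorentzMetric n M) (x : M) (v w : TangentSpace (𝓡 n) x) : ℝ :=
  ∑ i, ∑ j, ricciCoord (formCoord g.val x) i j (extChartAt (𝓡 n) x x)
    * vecCoord x x v i * vecCoord x x w j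

/-- The scalar curvature. -/
def scalarCurvature (g : LorentzMetric n M) (x : M) : ℝ :=
  scalarCurvatureCoord (formCoord g.val x) (extChartAt (𝓡 n) x x)

/-- The Einstein tensor `Ric - ½ R g`. -/
def einstein (g : LorentzMetric n M) (x : M) (v w : TangentSpace (𝓡 n) x) : ℝ :=
  g.ricci x v w - (1 / 2) * g.scalarCurvature x * g.val x v w

end

/-! ### Hypersurfaces -/

section

variable {n d : ℕ} {M : Type*} [TopologicalSpace M] [ChartedSpace (EuclideanSpace ℝ (Fin n)) M]
  [IsManifold (𝓡 n) ∞ M] {S : Type*} [TopologicalSpace S]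
  [ChartedSpace (EuclideanSpace ℝ (Fin d)) S]

/-- The Levi-Civita derivative `∇_X V` at `p` of a field `V` of tangent vectors of `M` given along
`ι : S → M`, in the direction of a vector `X` tangent to `S`; in coordinates
`(∇_X V)ᵏ = X(Vᵏ) + Γᵏᵢⱼ Xⁱ Vʲ`. For `V` the restriction of a vector field on `M` it is the
ordinary covariant derivative in the direction of the image of `X`. -/
def covDerivAlong (g : LorentzMetric n M) (ι : S → M) (V : ∀ p : S, TangentSpace (𝓡 n) (ι p))
    (p : S) (X : TangentSpace (𝓡 d) p) : TangentSpace (𝓡 n) (ι p) :=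
  let u := extChartAt (𝓡 n) (ι p) (ι p)
  let Vc : S → EuclideanSpace ℝ (Fin n) := fun p' => vecCoord (ι p) (ι p') (V p')
  let Xc : EuclideanSpace ℝ (Fin n) := vecCoord (ι p) (ι p) (mfderiv (𝓡 d) (𝓡 n) ι p X)
  let dV : EuclideanSpace ℝ (Fin n) := mfderiv (𝓡 d) 𝓘(ℝ, EuclideanSpace ℝ (Fin n)) Vc p X
  let D : EuclideanSpace ℝ (Fin n) := WithLp.toLp 2 fun k =>
    dV k + ∑ i, ∑ j, christoffel (formCoord g.val (ι p)) k i j u * Xc i * Vc p j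
  (mfderiv (𝓡 n) 𝓘(ℝ, EuclideanSpace ℝ (Fin n)) (extChartAt (𝓡 n) (ι p)) (ι p)).inverse D

/-- The induced tensor `q = ι^* g` on `S`. -/
def induced (g : LorentzMetric n M) (ι : S → M) (p : S) :
    TangentSpace (𝓡 d) p →L[ℝ] TangentSpace (𝓡 d) p →L[ℝ] ℝ :=
  let b : EuclideanSpace ℝ (Fin n) →L[ℝ] EuclideanSpace ℝ (Fin n) →L[ℝ] ℝ := g.val (ι p)
  let A : EuclideanSpace ℝ (Fin d) →L[ℝ] EuclideanSpace ℝ (Fin n) := mfderiv (𝓡 d) (𝓡 n) ι p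
  b.bilinearComp A A

lemma induced_apply (g : LorentzMetric n M) (ι : S → M) (p : S) (X Y : TangentSpace (𝓡 d) p) :
    g.induced ι p X Y
      = g.val (ι p) (mfderiv (𝓡 d) (𝓡 n) ι p X) (mfderiv (𝓡 d) (𝓡 n) ι p Y) :=
  rfl

/-- The pullback to `S` of `∇_α ℓ_β`, for a vector field `ℓ` on `S`:
`B(X, Y) = g(∇_X ℓ, Y)` for `X`, `Y` tangent to `S`. -/
def derivTensor (g : LorentzMetric n M) (ι : S → M) (ℓ : ∀ p : S, TangentSpace (𝓡 d) p) (p : S)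
    (X Y : TangentSpace (𝓡 d) p) : ℝ :=
  g.val (ι p) (g.covDerivAlong ι (fun p' => mfderiv (𝓡 d) (𝓡 n) ι p' (ℓ p')) p X)
    (mfderiv (𝓡 d) (𝓡 n) ι p Y)

/-- The degeneracy subspace `L_p ⊆ T_p S` of the induced tensor `q`. -/
def nullDirection (g : LorentzMetric n M) (ι : S → M) (p : S) :
    Submodule ℝ (TangentSpace (𝓡 d) p) :=
  LinearMap.ker (g.induced (d := d) ι p).toLinearMap

/-- Vectors in `T_p S` whose classes form a basis of `T_p S / L_p`. -/
def screenBasis (g : LorentzMetric n M) (ι : S → M) (p : S)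
    (A : Fin (finrank ℝ (TangentSpace (𝓡 d) p ⧸ g.nullDirection (d := d) ι p))) :
    TangentSpace (𝓡 d) p :=
  haveI : FiniteDimensional ℝ (TangentSpace (𝓡 d) p) :=
    inferInstanceAs (FiniteDimensional ℝ (EuclideanSpace ℝ (Fin d)))
  Quotient.out (finBasis ℝ (TangentSpace (𝓡 d) p ⧸ g.nullDirection (d := d) ι p) A)

/-- The expansion `θ = q̄^{AB} B̄_{AB}` of a null vector field `ℓ` on a null hypersurface: the trace
of the tensor which `B` induces on `T_p S / L_p` with respect to the metric `q̄` which `q` induces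
there. The components of the two induced tensors are those of `q` and `B` on representatives. -/
def expansion (g : LorentzMetric n M) (ι : S → M) (ℓ : ∀ p : S, TangentSpace (𝓡 d) p)
    (p : S) : ℝ :=
  let e := g.screenBasis (d := d) ι p
  let Q := Matrix.of fun A B => g.induced ι p (e A) (e B)
  ∑ A, ∑ B, Q⁻¹ A B * g.derivTensor ι ℓ p (e A) (e B)

/-- `ι : S → M` is a smooth immersion and the induced tensor is degenerate at every point
(for `dim S = dim M - 1`: a null hypersurface). -/
structure IsNullSurface (g : LorentzMetric n M) (ι : S → M) : Prop where
  contMDiff : ContMDiff (𝓡 d) (𝓡 n) ∞ ι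
  injective_mfderiv (p : S) : Function.Injective (mfderiv (𝓡 d) (𝓡 n) ι p)
  degenerate (p : S) : ∃ v : TangentSpace (𝓡 d) p, v ≠ 0 ∧
    ∀ w : TangentSpace (𝓡 d) p, g.induced ι p v w = 0

variable [IsManifold (𝓡 d) ∞ S]

/-- `ℓ` is a smooth vector field on the open subset `U` of `S` whose values are null vectors
(possibly zero). Values of `ℓ` outside of `U` are irrelevant. -/
structure IsNullField (g : LorentzMetric n M) (ι : S → M) (U : Set S)
    (ℓ : ∀ p : S, TangentSpace (𝓡 d) p) : Prop where
  isOpen : IsOpen U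
  contMDiffOn : ContMDiffOn (𝓡 d) (𝓡 d).tangent ∞
    (fun p => (⟨p, ℓ p⟩ : TangentBundle (𝓡 d) S)) U
  null (p : S) (hp : p ∈ U) : g.induced ι p (ℓ p) (ℓ p) = 0

/-- At every point the expansion of some local null vector field which is non-zero there
vanishes. -/
def IsNonExpanding (g : LorentzMetric n M) (ι : S → M) : Prop :=
  ∀ p : S, ∃ (U : Set S) (ℓ : ∀ p : S, TangentSpace (𝓡 d) p),
    g.IsNullField ι U ℓ ∧ p ∈ U ∧ ℓ p ≠ 0 ∧ g.expansion ι ℓ p = 0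

end

end LorentzMetric

end

/-! The proof is Raychaudhuri's equation for a null vector field `ℓ` tangent to the hypersurface,
read as a trace identity. A vector orthogonal to `ℓ` is tangent to the hypersurface
(`mem_range_of_orthogonal`), and `∇_X ℓ` is orthogonal to `ℓ` because `g(ℓ, ℓ) = 0`. Hence `∇_X ℓ =
W X` for a Weingarten map `W` of the tangent space. The form `g(W X, Y)` is symmetric because the
connection is torsion free; together with `∇_X ℓ ⟂ ℓ` this makes `W ℓ` null, so `W ℓ = κ ℓ`
(`exists_weingarten`). The expansion is the trace of `W` on the quotient by `ℓ`, that is `θ = tr W -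
κ` (`IsNullSurface.expansion_eq`).

The curvature operator `z ↦ R(z, ℓ) ℓ` has trace `Ric(ℓ, ℓ)`. Its values are orthogonal to `ℓ`,
hence tangent, so its trace is already that of its restriction to the hypersurface and no
transversal null vector is needed. On tangent vectors the operator satisfies a Riccati equation for
`W` (`curvatureForm_riccati`). If `tr W = κ` on a neighbourhood, taking traces leaves `Ric(ℓ, ℓ) =
κ² - tr W²` (`trace_curvatureForm_eq`). The right-hand side is minus the trace of the square of an
operator symmetric for a positive definite form. Thus it is nonpositive, and zero only if the
pullback of `∇ℓ` vanishes (`sq_le_trace_sq`). The Einstein equations and the energy condition give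
`Ric(ℓ, ℓ) ≥ 0`, so both sides vanish. Finally `ℒ_ℓ q` is twice the pullback of `∇ℓ`.

Two points need care. Non-expansion is assumed pointwise, with a field that may change from point to
point, whereas the trace argument differentiates `tr W = κ`. The gap is closed by tensoriality: the
pullback of `∇ℓ` at a point depends linearly on the value of `ℓ` there
(`IsNullSurface.derivTensor_eq_mul`). Moreover the covariant derivative is defined in a chart
centred at the point itself, while the calculus runs in one fixed chart. Agreement of the two
follows from the Lie derivative formula, whose other side does not involve the chart of the ambient
manifold (`IsNullSurface.derivTensor_eq`). -/

/-! ### Traces on quotients, symmetric operators, and null vectors of Lorentzian forms. -/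

section LinearAlgebra

/-- The trace of an endomorphism with an eigenvector `v` is the eigenvalue plus the trace on the
quotient by the line through `v`. -/
lemma trace_eq_add_trace_mapQ_span {T : Type*} [AddCommGroup T] [Module ℝ T]
    [FiniteDimensional ℝ T] (W : T →ₗ[ℝ] T) {v : T} {φ : T →ₗ[ℝ] ℝ} (hφ : φ v = 1) {κ : ℝ}
    (hW : W v = κ • v) (N : Submodule ℝ T) (hN : N = Submodule.span ℝ {v}) (h : N ≤ N.comap W) :
    LinearMap.trace ℝ T W = κ + LinearMap.trace ℝ (T ⧸ N) (N.mapQ N W h) := by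
  subst hN
  -- The section `x ↦ x - φ(x) v` identifies the quotient with `ker φ`. The induced endomorphism is
  -- the projection after `W ∘ s`, and cyclicity of the trace turns it into `W - φ ⊗ W v` on `T`.
  let s : (T ⧸ Submodule.span ℝ {v}) →ₗ[ℝ] T :=
    (Submodule.span ℝ {v}).liftQ (LinearMap.id - φ.smulRight v) (by
      rw [Submodule.span_singleton_le_iff_mem, LinearMap.mem_ker]
      simp [hφ])
  have h1 : (Submodule.span ℝ {v}).mapQ _ W h = (Submodule.span ℝ {v}).mkQ ∘ₗ (W ∘ₗ s) := by
    refine Submodule.linearMap_qext _ (LinearMap.ext fun x => ?_)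
    have h2 : Submodule.Quotient.mk (p := Submodule.span ℝ {v}) (W v) = 0 :=
      (Submodule.Quotient.mk_eq_zero _).2 (h (Submodule.mem_span_singleton_self v))
    simp [s, h2]
  have h3 : (W ∘ₗ s) ∘ₗ (Submodule.span ℝ {v}).mkQ = W - φ.smulRight (W v) := by
    ext x
    simp [s]
  rw [h1, LinearMap.trace_comp_comm', h3, map_sub, LinearMap.trace_smulRight, hW, map_smul, hφ]
  simp

/-- The trace of the endomorphism of `T ⧸ ker q` induced by `W`, in terms of the components of the
forms `q` and `q (W ·) ·`. -/
lemma sum_inv_mul_eq_trace_mapQ {T : Type*} [AddCommGroup T] [Module ℝ T]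
    (q : T →ₗ[ℝ] T →ₗ[ℝ] ℝ) (hq : ∀ x y, q x y = q y x) (N : Submodule ℝ T)
    (hN : ∀ x, x ∈ N ↔ ∀ y, q x y = 0) (W : T →ₗ[ℝ] T) (h : N ≤ N.comap W)
    {ι : Type*} [Fintype ι] [DecidableEq ι] (b : Basis ι ℝ (T ⧸ N)) (e : ι → T)
    (he : ∀ A, N.mkQ (e A) = b A) :
    ∑ A, ∑ B, (Matrix.of fun A B => q (e A) (e B))⁻¹ A B * q (W (e A)) (e B)
      = LinearMap.trace ℝ (T ⧸ N) (N.mapQ N W h) := by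
  set Q : Matrix ι ι ℝ := Matrix.of fun A B => q (e A) (e B) with hQ
  set C : Matrix ι ι ℝ := LinearMap.toMatrix b b (N.mapQ N W h) with hC
  have hmod : ∀ x x' y, N.mkQ x = N.mkQ x' → q x y = q x' y := by
    intro x x' y hx
    have hx' : x - x' ∈ N := (Submodule.Quotient.eq N).1 hx
    have := (hN _).1 hx' y
    simpa [sub_eq_zero] using this
  have hexp : ∀ x : T, N.mkQ x = N.mkQ (∑ C, b.repr (N.mkQ x) C • e C) := by
    intro x
    rw [map_sum]
    simp only [map_smul, he]
    exact (b.sum_repr _).symm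
  -- A vector in the kernel of `Q` gives a combination of the representatives orthogonal to
  -- everything, hence lying in `N`; independence of the basis `b` makes its coefficients zero.
  have hdet : IsUnit Q.det := by
    rw [isUnit_iff_ne_zero]
    intro h0
    obtain ⟨v, hv0, hv⟩ := Matrix.exists_mulVec_eq_zero_iff.2 h0
    apply hv0
    have hx : (∑ C, v C • e C) ∈ N := by
      rw [hN]
      intro y
      rw [hq, hmod _ _ _ (hexp y), map_sum q, LinearMap.sum_apply]
      refine Finset.sum_eq_zero fun A _ => ?_
      have := congrFun hv A
      simp only [Matrix.mulVec, dotProduct, hQ, Matrix.of_apply, Pi.zero_apply] at this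
      have h2 : q (e A) (∑ C, v C • e C) = 0 := by
        rw [← this, map_sum]
        exact Finset.sum_congr rfl fun _ _ => by rw [map_smul, smul_eq_mul, mul_comm]
      rw [map_smul, LinearMap.smul_apply, h2, smul_zero]
    have h2 : N.mkQ (∑ C, v C • e C) = 0 := (Submodule.Quotient.mk_eq_zero N).2 hx
    rw [map_sum] at h2
    simp only [map_smul, he] at h2
    exact funext (Fintype.linearIndependent_iff.1 b.linearIndependent v h2)
  -- Expand `W (e A)` modulo `N`, which `q` does not see. Contraction with `Q⁻¹` then cancels `Q`
  -- and leaves the trace of `C`.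
  have hB : ∀ A B, q (W (e A)) (e B) = (C.transpose * Q) A B := by
    intro A B
    rw [hmod _ _ _ (hexp (W (e A)))]
    simp only [map_sum, LinearMap.sum_apply, map_smul, LinearMap.smul_apply, Matrix.mul_apply,
      Matrix.transpose_apply, hC, hQ, Matrix.of_apply, LinearMap.toMatrix_apply, smul_eq_mul]
    refine Finset.sum_congr rfl fun D _ => ?_
    rw [← he A]
    rfl
  have hQs : Q.transpose = Q := by ext A B; simp [hQ, hq (e B)]
  have hQi : (Q⁻¹).transpose = Q⁻¹ := by rw [Matrix.transpose_nonsing_inv, hQs]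
  calc ∑ A, ∑ B, Q⁻¹ A B * q (W (e A)) (e B)
      = Matrix.trace ((Q⁻¹).transpose * (C.transpose * Q)) := by
        rw [Finset.sum_comm]
        simp only [Matrix.trace, Matrix.diag, Matrix.mul_apply (M := (Q⁻¹).transpose),
          Matrix.transpose_apply, hB]
    _ = Matrix.trace C := by
        rw [hQi, Matrix.trace_mul_comm, Matrix.mul_assoc, Matrix.mul_nonsing_inv _ hdet,
          Matrix.mul_one, Matrix.trace_transpose]
    _ = _ := by rw [hC, ← LinearMap.trace_eq_matrix_trace]

/-- The square of an endomorphism which is symmetric with respect to a positive definite form has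
non-negative trace, and the trace vanishes only for the zero endomorphism. -/
lemma trace_sq_nonneg_of_symmetric {T : Type*} [AddCommGroup T] [Module ℝ T]
    [FiniteDimensional ℝ T] (q : T →ₗ[ℝ] T →ₗ[ℝ] ℝ) (hq : ∀ x y, q x y = q y x)
    (hpos : ∀ x, x ≠ 0 → 0 < q x x) (W : T →ₗ[ℝ] T) (hW : ∀ x y, q (W x) y = q x (W y)) :
    0 ≤ LinearMap.trace ℝ T (W ∘ₗ W) ∧ (LinearMap.trace ℝ T (W ∘ₗ W) = 0 → W = 0) := by
  -- With `q` itself as the inner product, symmetry of `W` makes `tr W²` the sum of the squared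
  -- lengths of `W b i` over an orthonormal basis.
  let core : InnerProductSpace.Core ℝ T :=
    { inner := fun x y => q x y
      conj_inner_symm := fun x y => by simpa using hq y x
      re_inner_nonneg := fun x => by
        by_cases hx : x = 0
        · simp [hx]
        · simpa using (hpos x hx).le
      add_left := fun x y z => by simp
      smul_left := fun x y r => by simp
      definite := fun x hx => by
        by_contra h
        exact (hpos x h).ne' hx }
  let _ : NormedAddCommGroup T := core.toNormedAddCommGroup
  let _ : InnerProductSpace ℝ T := InnerProductSpace.ofCore core.toCore
  have hin : ∀ x y : T, inner ℝ x y = q x y := fun _ _ => rfl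
  let b := stdOrthonormalBasis ℝ T
  have key : LinearMap.trace ℝ T (W ∘ₗ W) = ∑ i, q (W (b i)) (W (b i)) := by
    rw [LinearMap.trace_eq_sum_inner _ b]
    refine Finset.sum_congr rfl fun i _ => ?_
    rw [hin, LinearMap.comp_apply, hW]
  have hnn : ∀ x, 0 ≤ q x x := fun x => by
    by_cases hx : x = 0
    · simp [hx]
    · exact (hpos x hx).le
  rw [key]
  refine ⟨Finset.sum_nonneg fun i _ => hnn _, fun h0 => ?_⟩
  rw [Finset.sum_eq_zero_iff_of_nonneg fun i _ => hnn _] at h0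
  refine b.toBasis.ext fun i => ?_
  by_contra h
  rw [OrthonormalBasis.coe_toBasis] at h
  exact (hpos _ h).ne' (h0 i (Finset.mem_univ i))

/-- If `q (W ·) ·` is symmetric, `q` is positive semidefinite with kernel spanned by `v`, and `v` is
an eigenvector of `W` with eigenvalue `κ`, then `κ² ≤ tr W²`, with equality only if `q (W ·) ·`
vanishes. -/
lemma sq_le_trace_sq {T : Type*} [AddCommGroup T] [Module ℝ T]
    [FiniteDimensional ℝ T] (q : T →ₗ[ℝ] T →ₗ[ℝ] ℝ) (hq : ∀ x y, q x y = q y x) (v : T)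
    (hnn : ∀ x, 0 ≤ q x x) (hker : ∀ x, q x x = 0 → ∃ c : ℝ, x = c • v)
    (hqv : ∀ y, q v y = 0) (W : T →ₗ[ℝ] T) (hW : ∀ x y, q (W x) y = q (W y) x) {κ : ℝ}
    (hWv : W v = κ • v) (φ : T →ₗ[ℝ] ℝ) (hφ : φ v = 1) :
    κ ^ 2 ≤ LinearMap.trace ℝ T (W ∘ₗ W) ∧
      (LinearMap.trace ℝ T (W ∘ₗ W) = κ ^ 2 → ∀ x y, q (W x) y = 0) := by
  -- This form is positive definite because `φ` detects the kernel direction of `q`. The modified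
  -- map `W'` below kills `v` and takes values in `ker φ`, so it is symmetric for `p` and models the
  -- action of `W` on the quotient by `v`.
  let p : T →ₗ[ℝ] T →ₗ[ℝ] ℝ := q + φ.smulRight φ
  have hp : ∀ x y, p x y = q x y + φ x * φ y := fun x y => by simp [p]
  let W' : T →ₗ[ℝ] T := W - (φ ∘ₗ W).smulRight v
  have hW' : ∀ x, W' x = W x - φ (W x) • v := fun x => by simp [W']
  have hqv' : ∀ y, q y v = 0 := fun y => by rw [hq, hqv]
  have hpW : ∀ x y, p (W' x) y = q (W x) y := by
    intro x y
    rw [hp, hW']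
    simp [hqv, hφ]
  have hsq : LinearMap.trace ℝ T (W' ∘ₗ W') = LinearMap.trace ℝ T (W ∘ₗ W) - κ ^ 2 := by
    have : W' ∘ₗ W' = W ∘ₗ W - (φ ∘ₗ W ∘ₗ W).smulRight v := by
      ext x
      simp only [LinearMap.comp_apply, hW', LinearMap.sub_apply, LinearMap.smulRight_apply,
        map_sub, map_smul, hWv, hφ, smul_eq_mul]
      module
    rw [this, map_sub]
    congr 1
    rw [show (φ ∘ₗ W ∘ₗ W).smulRight v = LinearMap.smulRight (φ ∘ₗ W ∘ₗ W) v from rfl,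
      LinearMap.trace_smulRight]
    simp [hWv, hφ, sq]
  have := trace_sq_nonneg_of_symmetric p (fun x y => by rw [hp, hp, hq x y]; ring)
    (fun x hx => by
      rw [hp]
      rcases (hnn x).lt_or_eq with h | h
      · have := mul_self_nonneg (φ x); linarith
      · obtain ⟨c, rfl⟩ := hker x h.symm
        have hc : c ≠ 0 := fun h => hx (by simp [h])
        have h2 : φ (c • v) = c := by simp [hφ]
        rw [h2, ← h]
        have := mul_self_pos.2 hc
        linarith) W'
    (fun x y => by
      rw [hpW, hW, ← hpW, hp, hp, hq]; ring)
  rw [hsq] at this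
  refine ⟨by linarith [this.1], fun h x y => ?_⟩
  rw [← hpW, this.2 (by linarith)]
  simp

/-- If `K` maps into the range of the injective map `A` and acts there by `J`, the traces of `K`
and `J` agree. -/
lemma trace_eq_of_comp_eq {D E : Type*} [AddCommGroup D] [Module ℝ D] [FiniteDimensional ℝ D]
    [AddCommGroup E] [Module ℝ E] [FiniteDimensional ℝ E] (A : D →ₗ[ℝ] E)
    (hA : Function.Injective A) (K : E →ₗ[ℝ] E) (J : D →ₗ[ℝ] D)
    (hK : ∀ z, K z ∈ LinearMap.range A) (hJ : ∀ x, K (A x) = A (J x)) :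
    LinearMap.trace ℝ E K = LinearMap.trace ℝ D J := by
  obtain ⟨P, hP⟩ := A.exists_leftInverse_of_injective (LinearMap.ker_eq_bot.2 hA)
  have hPA : ∀ x, P (A x) = x := fun x => LinearMap.congr_fun hP x
  have h1 : K = A ∘ₗ (P ∘ₗ K) := by
    ext z
    obtain ⟨x, hx⟩ := hK z
    simp [← hx, hPA]
  have h2 : J = (P ∘ₗ K) ∘ₗ A := by
    ext x
    simp [hJ, hPA]
  rw [h1, LinearMap.trace_comp_comm', ← h2]

/-- A vector which is orthogonal to a null vector `k ≠ 0` of a Lorentzian form is spacelike or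
a multiple of `k`. -/
lemma lorentz_nonneg_of_orthogonal {E : Type*} [AddCommGroup E] [Module ℝ E]
    (g : E →ₗ[ℝ] E →ₗ[ℝ] ℝ) (hg : ∀ x y, g x y = g y x)
    (hL : ∃ t, g t t < 0 ∧ ∀ v, g t v = 0 → v ≠ 0 → 0 < g v v) {k : E} (hk : k ≠ 0)
    (hkk : g k k = 0) (v : E) (hv : g k v = 0) :
    0 ≤ g v v ∧ (g v v = 0 → ∃ c : ℝ, v = c • k) := by
  obtain ⟨t, -, ht⟩ := hL
  -- Otherwise `k` would be spacelike. One can therefore subtract the multiple of `k` that makes `v`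
  -- orthogonal to `t`; this does not change `g v v`, since `k` is null and orthogonal to `v`.
  have htk : g t k ≠ 0 := fun h => (ht k h hk).ne' hkk
  set c := g t v / g t k with hc
  have h0 : g t (v - c • k) = 0 := by
    simp only [map_sub, map_smul, smul_eq_mul, hc]
    field_simp
    ring
  have h1 : g (v - c • k) (v - c • k) = g v v := by
    simp [hkk, hv, hg v k]
  by_cases hz : v - c • k = 0
  · rw [← h1, hz]
    exact ⟨by simp, fun _ => ⟨c, sub_eq_zero.1 hz⟩⟩
  · have := ht _ h0 hz
    rw [h1] at this
    exact ⟨this.le, fun h => absurd h this.ne'⟩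

/-- A Lorentzian form is nondegenerate. -/
lemma lorentz_nondegenerate {E : Type*} [AddCommGroup E] [Module ℝ E]
    (g : E →ₗ[ℝ] E →ₗ[ℝ] ℝ) (hg : ∀ x y, g x y = g y x)
    (hL : ∃ t, g t t < 0 ∧ ∀ v, g t v = 0 → v ≠ 0 → 0 < g v v) {v : E} (hv : ∀ w, g v w = 0) :
    v = 0 := by
  obtain ⟨t, -, ht⟩ := hL
  by_contra h
  exact (ht v (by rw [hg]; exact hv t) h).ne' (hv v)

/-- The vectors orthogonal to a degeneracy direction of a null hyperplane are those of the
hyperplane. -/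
lemma mem_range_of_orthogonal {D E : Type*} [AddCommGroup D] [Module ℝ D] [FiniteDimensional ℝ D]
    [AddCommGroup E] [Module ℝ E] [FiniteDimensional ℝ E] (hdim : finrank ℝ E = finrank ℝ D + 1)
    (g : E →ₗ[ℝ] E →ₗ[ℝ] ℝ) (hg : ∀ x y, g x y = g y x)
    (hL : ∃ t, g t t < 0 ∧ ∀ v, g t v = 0 → v ≠ 0 → 0 < g v v) (A : D →ₗ[ℝ] E)
    (hA : Function.Injective A) {v : D} (hv : v ≠ 0) (hq : ∀ y, g (A v) (A y) = 0) {z : E}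
    (hz : g (A v) z = 0) : z ∈ LinearMap.range A := by
  have hne : g (A v) ≠ 0 := fun h => hv (hA (by
    rw [map_zero]; exact lorentz_nondegenerate g hg hL fun w => by rw [h]; rfl))
  have hle : LinearMap.range A ≤ LinearMap.ker (g (A v)) := by
    rintro _ ⟨y, rfl⟩
    exact hq y
  -- The hyperplane lies in the orthogonal complement of its degeneracy direction, and both have
  -- codimension one.
  have hfr : finrank ℝ (LinearMap.range A) = finrank ℝ (LinearMap.ker (g (A v))) := by
    rw [LinearMap.finrank_range_of_inj hA]
    have := Module.Dual.finrank_ker_add_one_of_ne_zero hne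
    omega
  rw [Submodule.eq_of_le_of_finrank_eq hle hfr]
  exact hz

end LinearAlgebra

/-! ### Connections on vector spaces, curvature along a map, and the Riccati and Raychaudhuri
equations. -/

section CovariantCalculus

set_option maxSynthPendingDepth 3

open Filter Topology

variable {D E : Type*} [NormedAddCommGroup D] [NormedSpace ℝ D]
  [NormedAddCommGroup E] [NormedSpace ℝ E]

/-- The covariant derivative `∇_X V = X(V) + Γ(F_* X, V)` of a field `V` along the map `F`, for the
connection on a vector space with Christoffel form `Γ`. -/
noncomputable def covAlong (Γ : E → E →L[ℝ] E →L[ℝ] E) (F V : D → E) (u X : D) : E :=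
  fderiv ℝ V u X + Γ (F u) (fderiv ℝ F u X) (V u)

/-- The curvature `R(a, b) c` of the connection with Christoffel form `Γ`. -/
noncomputable def curvatureForm (Γ : E → E →L[ℝ] E →L[ℝ] E) (x a b c : E) : E :=
  fderiv ℝ Γ x a b c - fderiv ℝ Γ x b a c + Γ x a (Γ x b c) - Γ x b (Γ x a c)

/-- `g` is parallel for the connection with Christoffel form `Γ`. -/
noncomputable def IsParallelAt (Γ : E → E →L[ℝ] E →L[ℝ] E) (g : E → E →L[ℝ] E →L[ℝ] ℝ) (x : E) : Prop :=
  ∀ z v w, fderiv ℝ g x z v w = g x (Γ x z v) w + g x v (Γ x z w)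

lemma fderiv_metric_apply {Γ : E → E →L[ℝ] E →L[ℝ] E} {g : E → E →L[ℝ] E →L[ℝ] ℝ}
    {F V V' : D → E} {u : D} (hg : DifferentiableAt ℝ g (F u)) (hF : DifferentiableAt ℝ F u)
    (hV : DifferentiableAt ℝ V u) (hV' : DifferentiableAt ℝ V' u) (hΓ : IsParallelAt Γ g (F u))
    (X : D) :
    fderiv ℝ (fun u => g (F u) (V u) (V' u)) u X
      = g (F u) (covAlong Γ F V u X) (V' u) + g (F u) (V u) (covAlong Γ F V' u X) := by
  have h1 : HasFDerivAt (fun u => g (F u)) (fderiv ℝ g (F u) ∘L fderiv ℝ F u) u :=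
    hg.hasFDerivAt.comp u hF.hasFDerivAt
  have h2 := (h1.clm_apply hV.hasFDerivAt).clm_apply hV'.hasFDerivAt
  rw [h2.fderiv]
  simp only [covAlong, _root_.add_apply, ContinuousLinearMap.comp_apply,
    ContinuousLinearMap.flip_apply, map_add, hΓ _ _ _]
  ring

/-- Constant fields on the parameter space commute, so torsion-freeness together with the symmetry
of second derivatives gives the exchange. It is the source of the symmetry of the second fundamental
form. -/
lemma covAlong_fderiv_comm {Γ : E → E →L[ℝ] E →L[ℝ] E} {F : D → E} {u : D}
    (hF : ContDiffAt ℝ 2 F u) (hΓ : ∀ v w, Γ (F u) v w = Γ (F u) w v) (X Y : D) :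
    covAlong Γ F (fun u => fderiv ℝ F u Y) u X = covAlong Γ F (fun u => fderiv ℝ F u X) u Y := by
  have hd : DifferentiableAt ℝ (fderiv ℝ F) u :=
    (hF.fderiv_right (m := 1) (by norm_num)).differentiableAt (by norm_num)
  have h : ∀ X Y, fderiv ℝ (fun u => fderiv ℝ F u Y) u X = fderiv ℝ (fderiv ℝ F) u X Y := by
    intro X Y
    rw [(hd.hasFDerivAt.clm_apply (hasFDerivAt_const Y u)).fderiv]
    simp
  have hs : fderiv ℝ (fderiv ℝ F) u X Y = fderiv ℝ (fderiv ℝ F) u Y X :=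
    (hF.isSymmSndFDerivAt (by simp)).eq X Y
  simp only [covAlong, h, hs, hΓ (fderiv ℝ F u X)]

/-- Product rule: one term freezes the value of `L` at `u`, the other differentiates `L`. Freezing
reduces computations with variable fields to constant ones, to which the exchange rule applies. -/
lemma covAlong_fderiv_apply {Γ : E → E →L[ℝ] E →L[ℝ] E} {F : D → E} {L : D → D} {u : D}
    (hF : ContDiffAt ℝ 2 F u) (hL : DifferentiableAt ℝ L u) (X : D) :
    covAlong Γ F (fun u => fderiv ℝ F u (L u)) u X
      = covAlong Γ F (fun u' => fderiv ℝ F u' (L u)) u X + fderiv ℝ F u (fderiv ℝ L u X) := by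
  have hd : DifferentiableAt ℝ (fderiv ℝ F) u :=
    (hF.fderiv_right (m := 1) (by norm_num)).differentiableAt (by norm_num)
  simp only [covAlong]
  rw [(hd.hasFDerivAt.clm_apply (hasFDerivAt_const (L u) u)).fderiv,
    (hd.hasFDerivAt.clm_apply hL.hasFDerivAt).fderiv]
  simp only [_root_.add_apply, ContinuousLinearMap.comp_apply,
    ContinuousLinearMap.flip_apply]
  simp
  abel

/-- The curvature of the pulled back connection, for a field `V` with `∇_X V = F_* (W X)`. -/
lemma curvatureForm_fderiv {Γ : E → E →L[ℝ] E →L[ℝ] E} {F V : D → E} {W : D → D →L[ℝ] D} {u : D}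
    (hF : ContDiffAt ℝ 2 F u) (hV : ContDiffAt ℝ 2 V u) (hW : DifferentiableAt ℝ W u)
    (hΓ : DifferentiableAt ℝ Γ (F u))
    (h : ∀ᶠ u in 𝓝 u, ∀ X, covAlong Γ F V u X = fderiv ℝ F u (W u X)) (X Y : D) :
    curvatureForm Γ (F u) (fderiv ℝ F u X) (fderiv ℝ F u Y) (V u)
      = covAlong Γ F (fun u' => fderiv ℝ F u' (W u Y)) u X
        - covAlong Γ F (fun u' => fderiv ℝ F u' (W u X)) u Y
        + fderiv ℝ F u (fderiv ℝ W u X Y - fderiv ℝ W u Y X) := by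
  have hdF : HasFDerivAt (fderiv ℝ F) (fderiv ℝ (fderiv ℝ F) u) u :=
    ((hF.fderiv_right (m := 1) (by norm_num)).differentiableAt (by norm_num)).hasFDerivAt
  have hdV : HasFDerivAt (fderiv ℝ V) (fderiv ℝ (fderiv ℝ V) u) u :=
    ((hV.fderiv_right (m := 1) (by norm_num)).differentiableAt (by norm_num)).hasFDerivAt
  have hF1 : HasFDerivAt F (fderiv ℝ F u) u := (hF.differentiableAt (by norm_num)).hasFDerivAt
  have hV1 : HasFDerivAt V (fderiv ℝ V u) u := (hV.differentiableAt (by norm_num)).hasFDerivAt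
  have hΓ1 : HasFDerivAt (fun u => Γ (F u)) (fderiv ℝ Γ (F u) ∘L fderiv ℝ F u) u :=
    hΓ.hasFDerivAt.comp u hF1
  have hsF : ∀ X Y, fderiv ℝ (fderiv ℝ F) u X Y = fderiv ℝ (fderiv ℝ F) u Y X := fun X Y =>
    (hF.isSymmSndFDerivAt (by simp)).eq X Y
  have hsV : ∀ X Y, fderiv ℝ (fderiv ℝ V) u X Y = fderiv ℝ (fderiv ℝ V) u Y X := fun X Y =>
    (hV.isSymmSndFDerivAt (by simp)).eq X Y
  -- The equation `∇_Y V = F_* (W Y)`, valid near `u`, differentiated in the direction `X`. On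
  -- antisymmetrising, the second derivatives of `V` and the terms `Γ(F'', V)` cancel; substituting
  -- for the remaining first derivatives of `V` produces the quadratic part of the curvature.
  have key : ∀ X Y, fderiv ℝ (fderiv ℝ V) u X Y
      + (fderiv ℝ Γ (F u) (fderiv ℝ F u X) (fderiv ℝ F u Y) (V u)
        + Γ (F u) (fderiv ℝ (fderiv ℝ F) u X Y) (V u)
        + Γ (F u) (fderiv ℝ F u Y) (fderiv ℝ V u X))
      = fderiv ℝ (fderiv ℝ F) u X (W u Y) + fderiv ℝ F u (fderiv ℝ W u X Y) := by
    intro X Y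
    have hY := hasFDerivAt_const (𝕜 := ℝ) Y u
    have h1 := (hdV.clm_apply hY).add ((hΓ1.clm_apply (hdF.clm_apply hY)).clm_apply hV1)
    have h2 := hdF.clm_apply (hW.hasFDerivAt.clm_apply hY)
    have h3 : (fun u => fderiv ℝ V u Y + Γ (F u) (fderiv ℝ F u Y) (V u))
        =ᶠ[𝓝 u] fun u => fderiv ℝ F u (W u Y) := h.mono fun u hu => hu Y
    have h4 := congrArg (fun T : D →L[ℝ] E => T X) (h1.unique (h2.congr_of_eventuallyEq h3))
    simp only [_root_.add_apply, ContinuousLinearMap.comp_apply,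
      ContinuousLinearMap.flip_apply, _root_.zero_apply, map_zero, zero_add] at h4
    rw [← add_comm (fderiv ℝ F u _), ← h4]
    abel
  have hu := h.self_of_nhds
  have hVX : ∀ X, fderiv ℝ V u X
      = fderiv ℝ F u (W u X) - Γ (F u) (fderiv ℝ F u X) (V u) := fun X => by
    rw [← hu]; simp [covAlong]
  have hS : ∀ X Y, covAlong Γ F (fun u' => fderiv ℝ F u' Y) u X
      = fderiv ℝ (fderiv ℝ F) u X Y + Γ (F u) (fderiv ℝ F u X) (fderiv ℝ F u Y) := by
    intro X Y
    rw [covAlong, (hdF.clm_apply (hasFDerivAt_const Y u)).fderiv]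
    simp
  have k1 := key X Y
  have k2 := key Y X
  rw [hVX] at k1 k2
  rw [hS, hS, curvatureForm, map_sub]
  rw [hsV Y X, hsF Y X] at k2
  simp only [map_sub] at k1 k2
  have := congrArg₂ (· - ·) k1 k2
  rw [← sub_eq_zero] at this ⊢
  rw [← this]
  abel

/-- The Riccati equation for the Weingarten map `W` of a field `V = F_* L` with `W L = κ L`. -/
lemma curvatureForm_riccati {Γ : E → E →L[ℝ] E →L[ℝ] E} {F : D → E} {L : D → D}
    {W : D → D →L[ℝ] D} {κ : D → ℝ} {u : D}
    (hF : ContDiffAt ℝ 3 F u) (hL : ContDiffAt ℝ 2 L u) (hW : DifferentiableAt ℝ W u)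
    (hκ : DifferentiableAt ℝ κ u)
    (hΓ : DifferentiableAt ℝ Γ (F u)) (hΓs : ∀ v w, Γ (F u) v w = Γ (F u) w v)
    (h : ∀ᶠ u in 𝓝 u, ∀ X,
      covAlong Γ F (fun u => fderiv ℝ F u (L u)) u X = fderiv ℝ F u (W u X))
    (hWL : ∀ᶠ u in 𝓝 u, W u (L u) = κ u • L u) (X : D) :
    curvatureForm Γ (F u) (fderiv ℝ F u X) (fderiv ℝ F u (L u)) (fderiv ℝ F u (L u))
      = fderiv ℝ F u (fderiv ℝ κ u X • L u + κ u • W u X - W u (W u X) - fderiv ℝ W u (L u) X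
          + fderiv ℝ L u (W u X) - W u (fderiv ℝ L u X)) := by
  have hF2 : ContDiffAt ℝ 2 F u := hF.of_le (by norm_num)
  have hL1 : DifferentiableAt ℝ L u := hL.differentiableAt (by norm_num)
  have hV : ContDiffAt ℝ 2 (fun u => fderiv ℝ F u (L u)) u :=
    (hF.fderiv_right (m := 2) (by norm_num)).clm_apply hL
  rw [curvatureForm_fderiv hF2 hV hW hΓ h X (L u)]
  have hu := h.self_of_nhds
  have hS : ∀ X, covAlong Γ F (fun u' => fderiv ℝ F u' (L u)) u X
      = fderiv ℝ F u (W u X) - fderiv ℝ F u (fderiv ℝ L u X) := fun X => by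
    rw [← hu, covAlong_fderiv_apply hF2 hL1]; simp
  -- Both `κ` and `L` are frozen at `u` here. After exchanging the two directions, linearity in the
  -- differentiation direction extracts the factor.
  have hS' : ∀ X, covAlong Γ F (fun u' => fderiv ℝ F u' (κ u • L u)) u X
      = κ u • covAlong Γ F (fun u' => fderiv ℝ F u' (L u)) u X := fun X => by
    rw [covAlong_fderiv_comm hF2 hΓs, covAlong_fderiv_comm hF2 hΓs X]
    simp only [covAlong, map_smul, _root_.smul_apply, smul_add]
  -- The derivative of `W L = κ L`; it eliminates the derivative of `W` evaluated on `L`, which is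
  -- why the eigenvector equation is required near `u` and not only at `u`.
  have hWL' : fderiv ℝ W u X (L u) + W u (fderiv ℝ L u X)
      = fderiv ℝ κ u X • L u + κ u • fderiv ℝ L u X := by
    have h1 := hW.hasFDerivAt.clm_apply hL1.hasFDerivAt
    have h2 := hκ.hasFDerivAt.smul hL1.hasFDerivAt
    have h4 := congrArg (fun T : D →L[ℝ] D => T X) (h1.unique (h2.congr_of_eventuallyEq hWL))
    simp only [_root_.add_apply, ContinuousLinearMap.comp_apply,
      ContinuousLinearMap.flip_apply, _root_.smul_apply,
      ContinuousLinearMap.smulRight_apply] at h4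
    rw [add_comm, h4, add_comm]
  rw [hWL.self_of_nhds, hS', hS, covAlong_fderiv_comm hF2 hΓs (L u), hS,
    eq_sub_of_add_eq hWL']
  simp only [map_add, map_sub, map_smul, smul_sub]
  abel

/-- Raychaudhuri's equation for a field with vanishing expansion `tr W - κ`. -/
lemma trace_curvatureForm_eq [FiniteDimensional ℝ D] [FiniteDimensional ℝ E]
    {Γ : E → E →L[ℝ] E →L[ℝ] E} {F : D → E} {L : D → D}
    {W : D → D →L[ℝ] D} {κ : D → ℝ} {u : D}
    (hF : ContDiffAt ℝ 3 F u) (hL : ContDiffAt ℝ 2 L u) (hW : DifferentiableAt ℝ W u)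
    (hκ : DifferentiableAt ℝ κ u)
    (hΓ : DifferentiableAt ℝ Γ (F u)) (hΓs : ∀ v w, Γ (F u) v w = Γ (F u) w v)
    (h : ∀ᶠ u in 𝓝 u, ∀ X,
      covAlong Γ F (fun u => fderiv ℝ F u (L u)) u X = fderiv ℝ F u (W u X))
    (hWL : ∀ᶠ u in 𝓝 u, W u (L u) = κ u • L u)
    (hθ : ∀ᶠ u in 𝓝 u, LinearMap.trace ℝ D (W u : D →ₗ[ℝ] D) = κ u)
    (hinj : Function.Injective (fderiv ℝ F u)) (K : E →ₗ[ℝ] E)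
    (hK : ∀ z, K z = curvatureForm Γ (F u) z (fderiv ℝ F u (L u)) (fderiv ℝ F u (L u)))
    (hKr : ∀ z, K z ∈ LinearMap.range (fderiv ℝ F u : D →ₗ[ℝ] E)) :
    LinearMap.trace ℝ E K
      = κ u ^ 2 - LinearMap.trace ℝ D ((W u : D →ₗ[ℝ] D) ∘ₗ (W u : D →ₗ[ℝ] D)) := by
  let w : D →ₗ[ℝ] D := W u
  let A : D →ₗ[ℝ] D := fderiv ℝ L u
  let J : D →ₗ[ℝ] D := LinearMap.smulRight (fderiv ℝ κ u : D →ₗ[ℝ] ℝ) (L u) + κ u • w - w ∘ₗ w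
    - (fderiv ℝ W u (L u) : D →ₗ[ℝ] D) + A ∘ₗ w - w ∘ₗ A
  rw [trace_eq_of_comp_eq (fderiv ℝ F u : D →ₗ[ℝ] E) hinj K J hKr fun x => by
    rw [hK]
    exact curvatureForm_riccati hF hL hW hκ hΓ hΓs h hWL x]
  -- Here vanishing expansion is used on a neighbourhood: the identity `tr W = κ` is differentiated
  -- along `L`. The result cancels the trace of `dκ ⊗ L` in `J`.
  have htr : LinearMap.trace ℝ D (fderiv ℝ W u (L u) : D →ₗ[ℝ] D) = fderiv ℝ κ u (L u) := by
    let τ : (D →L[ℝ] D) →L[ℝ] ℝ :=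
      LinearMap.toContinuousLinearMap (LinearMap.trace ℝ D ∘ₗ ContinuousLinearMap.coeLM ℝ)
    have hτ : ∀ B : D →L[ℝ] D, τ B = LinearMap.trace ℝ D (B : D →ₗ[ℝ] D) := fun B => rfl
    have h1 : HasFDerivAt (fun u => τ (W u)) (τ ∘L fderiv ℝ W u) u :=
      τ.hasFDerivAt.comp u hW.hasFDerivAt
    have h2 := h1.unique (hκ.hasFDerivAt.congr_of_eventuallyEq
      (hθ.mono fun u hu => (hτ _).trans hu))
    rw [← h2]
    rfl
  have hθu := hθ.self_of_nhds
  simp only [J, map_sub, map_add, map_smul, LinearMap.trace_smulRight, htr]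
  -- The terms with the derivative of `L` form a commutator and have no trace.
  rw [LinearMap.trace_comp_comm' A w]
  change _ + κ u • LinearMap.trace ℝ D (W u : D →ₗ[ℝ] D) - _ - _ + _ - _ = _
  rw [hθu]
  simp only [w, smul_eq_mul, ContinuousLinearMap.coe_coe]
  ring

/-- The curvature of a metric connection is antisymmetric. -/
lemma metric_curvatureForm_self {Γ : E → E →L[ℝ] E →L[ℝ] E} {g : E → E →L[ℝ] E →L[ℝ] ℝ} {x : E}
    (hg : ContDiffAt ℝ 2 g x) (hgs : ∀ᶠ y in 𝓝 x, ∀ v w, g y v w = g y w v)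
    (hΓ : DifferentiableAt ℝ Γ x) (hp : ∀ᶠ y in 𝓝 x, IsParallelAt Γ g y) (a b c : E) :
    g x (curvatureForm Γ x a b c) c = 0 := by
  have hd : HasFDerivAt (fderiv ℝ g) (fderiv ℝ (fderiv ℝ g) x) x :=
    ((hg.fderiv_right (m := 1) (by norm_num)).differentiableAt (by norm_num)).hasFDerivAt
  have hg1 : HasFDerivAt g (fderiv ℝ g x) x := (hg.differentiableAt (by norm_num)).hasFDerivAt
  have hs : fderiv ℝ (fderiv ℝ g) x a b = fderiv ℝ (fderiv ℝ g) x b a :=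
    (hg.isSymmSndFDerivAt (by simp)).eq a b
  have hpx := hp.self_of_nhds
  have hgx := hgs.self_of_nhds
  -- Metric compatibility on the pair `c, c`, differentiated once more. The left side is symmetric
  -- in `a, b`, and so is the term with two separate Christoffel factors; the difference of the two
  -- versions is twice the claim.
  have key : ∀ a b, fderiv ℝ (fderiv ℝ g) x a b c c
      = 2 * (g x (Γ x a (Γ x b c)) c + g x (Γ x b c) (Γ x a c) + g x (fderiv ℝ Γ x a b c) c) := by
    intro a b
    have hb := hasFDerivAt_const (𝕜 := ℝ) b x
    have hc := hasFDerivAt_const (𝕜 := ℝ) c x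
    have h1 := ((hd.clm_apply hb).clm_apply hc).clm_apply hc
    have h2 := ((hg1.clm_apply ((hΓ.hasFDerivAt.clm_apply hb).clm_apply hc)).clm_apply hc).const_mul
      (2 : ℝ)
    have h3 : (fun y => fderiv ℝ g y b c c) =ᶠ[𝓝 x] fun y => 2 * g y (Γ y b c) c := by
      filter_upwards [hp, hgs] with y hy hys
      rw [hy, hys c]
      ring
    have h4 := congrArg (fun T : E →L[ℝ] ℝ => T a) (h1.unique (h2.congr_of_eventuallyEq h3))
    simp only [_root_.add_apply, ContinuousLinearMap.comp_apply,
      ContinuousLinearMap.flip_apply, _root_.zero_apply, map_zero, zero_add,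
      _root_.smul_apply, smul_eq_mul] at h4
    rw [h4, hpx]
    ring
  have k := key a b
  rw [hs, key b a, hgx (Γ x a c)] at k
  simp only [curvatureForm, map_add, map_sub, _root_.add_apply,
    _root_.sub_apply]
  linarith

end CovariantCalculus

/-! ### The Levi-Civita connection and the Ricci tensor of a matrix of metric components. -/

section Christoffel

open Filter Topology

set_option maxSynthPendingDepth 3

lemma contDiffAt_matrix_det {X : Type*} [NormedAddCommGroup X] [NormedSpace ℝ X] {ι : Type*}
    [Fintype ι] [DecidableEq ι] {A : X → Matrix ι ι ℝ} {x : X} {m : WithTop ℕ∞}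
    (hA : ∀ i j, ContDiffAt ℝ m (fun u => A u i j) x) : ContDiffAt ℝ m (fun u => (A u).det) x := by
  simp only [Matrix.det_apply]
  exact ContDiffAt.sum fun σ _ => (contDiffAt_prod fun i _ => hA _ _).const_smul _

lemma contDiffAt_matrix_inv {X : Type*} [NormedAddCommGroup X] [NormedSpace ℝ X] {ι : Type*}
    [Fintype ι] [DecidableEq ι] {A : X → Matrix ι ι ℝ} {x : X} {m : WithTop ℕ∞}
    (hA : ∀ i j, ContDiffAt ℝ m (fun u => A u i j) x) (hx : (A x).det ≠ 0) (i j : ι) :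
    ContDiffAt ℝ m (fun u => (A u)⁻¹ i j) x := by
  simp only [Matrix.inv_def, Ring.inverse_eq_inv', Matrix.smul_apply, smul_eq_mul,
    Matrix.adjugate_apply]
  refine ((contDiffAt_matrix_det hA).inv hx).mul (contDiffAt_matrix_det fun a b => ?_)
  by_cases h : a = j
  · subst h
    simpa using contDiffAt_const
  · simpa [Matrix.updateRow_ne h] using hA a b

variable {n : ℕ}

lemma fderiv_eq_sum_partialDeriv (f : EuclideanSpace ℝ (Fin n) → ℝ) (x z : EuclideanSpace ℝ (Fin n)) :
    fderiv ℝ f x z = ∑ k, z k * partialDeriv k f x := by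
  conv_lhs => rw [← (EuclideanSpace.basisFun (Fin n) ℝ).sum_repr z]
  simp [partialDeriv]

/-- The bilinear form with matrix `G x`. -/
noncomputable def matrixForm (G : EuclideanSpace ℝ (Fin n) → Matrix (Fin n) (Fin n) ℝ) (x : EuclideanSpace ℝ (Fin n)) : EuclideanSpace ℝ (Fin n) →L[ℝ] EuclideanSpace ℝ (Fin n) →L[ℝ] ℝ :=
  ∑ i, ∑ j, G x i j • (EuclideanSpace.proj i : EuclideanSpace ℝ (Fin n) →L[ℝ] ℝ).smulRight
    (EuclideanSpace.proj j : EuclideanSpace ℝ (Fin n) →L[ℝ] ℝ)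

lemma matrixForm_apply (G : EuclideanSpace ℝ (Fin n) → Matrix (Fin n) (Fin n) ℝ) (x v w : EuclideanSpace ℝ (Fin n)) :
    matrixForm G x v w = ∑ i, ∑ j, G x i j * v i * w j := by
  simp [matrixForm, mul_assoc]

/-- The bilinear map whose components are the Christoffel symbols of `G`. -/
noncomputable def christoffelForm (G : EuclideanSpace ℝ (Fin n) → Matrix (Fin n) (Fin n) ℝ) (x : EuclideanSpace ℝ (Fin n)) : EuclideanSpace ℝ (Fin n) →L[ℝ] EuclideanSpace ℝ (Fin n) →L[ℝ] EuclideanSpace ℝ (Fin n) :=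
  ∑ k, ∑ i, ∑ j, christoffel G k i j x • (EuclideanSpace.proj i : EuclideanSpace ℝ (Fin n) →L[ℝ] ℝ).smulRight
    ((EuclideanSpace.proj j : EuclideanSpace ℝ (Fin n) →L[ℝ] ℝ).smulRight (EuclideanSpace.single k (1 : ℝ)))

lemma christoffelForm_apply (G : EuclideanSpace ℝ (Fin n) → Matrix (Fin n) (Fin n) ℝ) (x v w : EuclideanSpace ℝ (Fin n)) (k : Fin n) :
    christoffelForm G x v w k = ∑ i, ∑ j, christoffel G k i j x * v i * w j := by
  simp only [christoffelForm, _root_.sum_apply, smul_apply,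
    ContinuousLinearMap.smulRight_apply, PiLp.proj_apply, PiLp.smul_apply,
    WithLp.ofLp_sum, Finset.sum_apply, PiLp.single_apply, smul_eq_mul]
  rw [Finset.sum_eq_single k (fun b _ hb => by simp [hb.symm]) (by simp)]
  simp [mul_assoc]

variable {G : EuclideanSpace ℝ (Fin n) → Matrix (Fin n) (Fin n) ℝ} {x : EuclideanSpace ℝ (Fin n)}

lemma contDiffAt_partialDeriv {f : EuclideanSpace ℝ (Fin n) → ℝ} {m k : WithTop ℕ∞} (hf : ContDiffAt ℝ m f x)
    (hk : k + 1 ≤ m) (i : Fin n) : ContDiffAt ℝ k (partialDeriv i f) x :=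
  (hf.fderiv_right hk).clm_apply contDiffAt_const

lemma contDiffAt_christoffel {m k : WithTop ℕ∞} (hG : ∀ i j, ContDiffAt ℝ m (fun u => G u i j) x)
    (hk : k + 1 ≤ m) (hx : (G x).det ≠ 0) (a i j : Fin n) :
    ContDiffAt ℝ k (christoffel G a i j) x := by
  have hkm : k ≤ m := le_self_add.trans hk
  refine contDiffAt_const.mul (ContDiffAt.sum fun l _ => ?_)
  exact ((contDiffAt_matrix_inv hG hx a l).of_le hkm).mul
    (((contDiffAt_partialDeriv (hG _ _) hk _).add (contDiffAt_partialDeriv (hG _ _) hk _)).sub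
      (contDiffAt_partialDeriv (hG _ _) hk _))

lemma contDiffAt_matrixForm {m : WithTop ℕ∞} (hG : ∀ i j, ContDiffAt ℝ m (fun u => G u i j) x) :
    ContDiffAt ℝ m (matrixForm G) x :=
  ContDiffAt.sum fun i _ => ContDiffAt.sum fun j _ => (hG i j).smul contDiffAt_const

lemma contDiffAt_christoffelForm {m k : WithTop ℕ∞}
    (hG : ∀ i j, ContDiffAt ℝ m (fun u => G u i j) x) (hk : k + 1 ≤ m) (hx : (G x).det ≠ 0) :
    ContDiffAt ℝ k (christoffelForm G) x :=
  ContDiffAt.sum fun a _ => ContDiffAt.sum fun i _ => ContDiffAt.sum fun j _ =>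
    (contDiffAt_christoffel hG hk hx a i j).smul contDiffAt_const

lemma fderiv_matrixForm (hG : ∀ i j, DifferentiableAt ℝ (fun u => G u i j) x) (z v w : EuclideanSpace ℝ (Fin n)) :
    fderiv ℝ (matrixForm G) x z v w
      = ∑ k, ∑ i, ∑ j, partialDeriv k (fun u => G u i j) x * z k * v i * w j := by
  have h1 : HasFDerivAt (matrixForm G) (∑ i, ∑ j, (fderiv ℝ (fun u => G u i j) x).smulRight
      ((EuclideanSpace.proj i : EuclideanSpace ℝ (Fin n) →L[ℝ] ℝ).smulRight (EuclideanSpace.proj j : EuclideanSpace ℝ (Fin n) →L[ℝ] ℝ))) x :=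
    HasFDerivAt.fun_sum fun i _ => HasFDerivAt.fun_sum fun j _ =>
      (hG i j).hasFDerivAt.smul_const _
  rw [h1.fderiv]
  simp only [_root_.sum_apply, smul_apply, ContinuousLinearMap.smulRight_apply,
    PiLp.proj_apply, smul_eq_mul, fderiv_eq_sum_partialDeriv, Finset.sum_mul]
  rw [Finset.sum_congr rfl fun i _ => Finset.sum_comm, Finset.sum_comm]
  refine Finset.sum_congr rfl fun k _ => Finset.sum_congr rfl fun i _ =>
    Finset.sum_congr rfl fun j _ => ?_
  ring

lemma fderiv_christoffelForm (hG : ∀ k i j, DifferentiableAt ℝ (christoffel G k i j) x)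
    (z v w : EuclideanSpace ℝ (Fin n)) (k : Fin n) :
    fderiv ℝ (christoffelForm G) x z v w k
      = ∑ i, ∑ j, fderiv ℝ (christoffel G k i j) x z * v i * w j := by
  have h1 : HasFDerivAt (christoffelForm G) (∑ k, ∑ i, ∑ j,
      (fderiv ℝ (christoffel G k i j) x).smulRight
      ((EuclideanSpace.proj i : EuclideanSpace ℝ (Fin n) →L[ℝ] ℝ).smulRight
        ((EuclideanSpace.proj j : EuclideanSpace ℝ (Fin n) →L[ℝ] ℝ).smulRight (EuclideanSpace.single k (1 : ℝ))))) x :=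
    HasFDerivAt.fun_sum fun k _ => HasFDerivAt.fun_sum fun i _ => HasFDerivAt.fun_sum fun j _ =>
      (hG k i j).hasFDerivAt.smul_const _
  rw [h1.fderiv]
  simp only [_root_.sum_apply, smul_apply,
    ContinuousLinearMap.smulRight_apply, PiLp.proj_apply, PiLp.smul_apply,
    WithLp.ofLp_sum, Finset.sum_apply, PiLp.single_apply, smul_eq_mul]
  rw [Finset.sum_eq_single k (fun b _ hb => by simp [hb.symm]) (by simp)]
  simp [mul_assoc]

lemma partialDeriv_symm (hGs : ∀ᶠ u in 𝓝 x, (G u).IsSymm) (k i j : Fin n) :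
    partialDeriv k (fun u => G u i j) x = partialDeriv k (fun u => G u j i) x := by
  have : (fun u => G u i j) =ᶠ[𝓝 x] fun u => G u j i := hGs.mono fun u hu => hu.apply j i
  rw [partialDeriv, this.fderiv_eq, partialDeriv]

lemma christoffelForm_symm (hGs : ∀ᶠ u in 𝓝 x, (G u).IsSymm) (v w : EuclideanSpace ℝ (Fin n)) :
    christoffelForm G x v w = christoffelForm G x w v := by
  have h : ∀ k i j, christoffel G k i j x = christoffel G k j i x := by
    intro k i j
    simp only [christoffel]
    congr 1
    refine Finset.sum_congr rfl fun l _ => ?_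
    rw [partialDeriv_symm hGs l i j]
    ring
  ext k
  rw [christoffelForm_apply, christoffelForm_apply, Finset.sum_comm]
  refine Finset.sum_congr rfl fun j _ => Finset.sum_congr rfl fun i _ => ?_
  rw [h]
  ring

/-- Lowering the upper index cancels the inverse matrix in the Christoffel symbols. -/
lemma sum_mul_christoffel (hGs : ∀ᶠ u in 𝓝 x, (G u).IsSymm) (hx : (G x).det ≠ 0)
    (k i j : Fin n) :
    ∑ m, G x m j * christoffel G m k i x
      = (1 / 2) * (partialDeriv k (fun w => G w i j) x + partialDeriv i (fun w => G w k j) x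
        - partialDeriv j (fun w => G w k i) x) := by
  set t : Fin n → ℝ := fun l => partialDeriv k (fun w => G w i l) x
    + partialDeriv i (fun w => G w k l) x - partialDeriv l (fun w => G w k i) x with ht
  have h1 : ∀ m, christoffel G m k i x = (1 / 2) * ((G x)⁻¹.mulVec t) m := fun m => rfl
  have h2 : ∑ m, G x m j * ((G x)⁻¹.mulVec t) m = t j := by
    have : (G x).mulVec ((G x)⁻¹.mulVec t) j = t j := by
      rw [Matrix.mulVec_mulVec, Matrix.mul_nonsing_inv _ (isUnit_iff_ne_zero.2 hx),
        Matrix.one_mulVec]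
    rw [← this]
    refine Finset.sum_congr rfl fun m _ => ?_
    rw [hGs.self_of_nhds.apply]
  calc ∑ m, G x m j * christoffel G m k i x
      = (1 / 2) * ∑ m, G x m j * ((G x)⁻¹.mulVec t) m := by
        rw [Finset.mul_sum]
        refine Finset.sum_congr rfl fun m _ => ?_
        rw [h1]
        ring
    _ = _ := by rw [h2]

/-- Koszul's formula for constant fields. Metric compatibility follows from it by adding two
instances. -/
lemma matrixForm_christoffelForm (hG : ∀ i j, DifferentiableAt ℝ (fun u => G u i j) x)
    (hGs : ∀ᶠ u in 𝓝 x, (G u).IsSymm) (hx : (G x).det ≠ 0) (z v w : EuclideanSpace ℝ (Fin n)) :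
    matrixForm G x (christoffelForm G x z v) w
      = (1 / 2) * (fderiv ℝ (matrixForm G) x z v w + fderiv ℝ (matrixForm G) x v z w
        - fderiv ℝ (matrixForm G) x w z v) := by
  have h1 : matrixForm G x (christoffelForm G x z v) w
      = ∑ k, ∑ i, ∑ j, (∑ m, G x m j * christoffel G m k i x) * (z k * v i * w j) := by
    simp only [matrixForm_apply, christoffelForm_apply, Finset.mul_sum, Finset.sum_mul]
    calc _ = ∑ m, ∑ k, ∑ i, ∑ j, G x m j * (christoffel G m k i x * z k * v i) * w j := by
          refine Finset.sum_congr rfl fun m _ => ?_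
          rw [Finset.sum_comm]
          exact Finset.sum_congr rfl fun k _ => Finset.sum_comm
      _ = ∑ k, ∑ i, ∑ j, ∑ m, G x m j * (christoffel G m k i x * z k * v i) * w j := by
          rw [Finset.sum_comm]
          refine Finset.sum_congr rfl fun k _ => ?_
          rw [Finset.sum_comm]
          exact Finset.sum_congr rfl fun i _ => Finset.sum_comm
      _ = _ := by
          refine Finset.sum_congr rfl fun k _ => Finset.sum_congr rfl fun i _ =>
            Finset.sum_congr rfl fun j _ => Finset.sum_congr rfl fun m _ => ?_
          ring
  have h2 : fderiv ℝ (matrixForm G) x v z w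
      = ∑ k, ∑ i, ∑ j, partialDeriv i (fun u => G u k j) x * (z k * v i * w j) := by
    rw [fderiv_matrixForm hG, Finset.sum_comm]
    refine Finset.sum_congr rfl fun k _ => Finset.sum_congr rfl fun i _ =>
      Finset.sum_congr rfl fun j _ => ?_
    ring
  have h3 : fderiv ℝ (matrixForm G) x w z v
      = ∑ k, ∑ i, ∑ j, partialDeriv j (fun u => G u k i) x * (z k * v i * w j) := by
    rw [fderiv_matrixForm hG, Finset.sum_comm]
    refine Finset.sum_congr rfl fun k _ => ?_
    rw [Finset.sum_comm]
    refine Finset.sum_congr rfl fun i _ => Finset.sum_congr rfl fun j _ => ?_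
    ring
  rw [h1, h2, h3, fderiv_matrixForm hG, ← Finset.sum_add_distrib, ← Finset.sum_sub_distrib,
    Finset.mul_sum]
  refine Finset.sum_congr rfl fun k _ => ?_
  rw [← Finset.sum_add_distrib, ← Finset.sum_sub_distrib, Finset.mul_sum]
  refine Finset.sum_congr rfl fun i _ => ?_
  rw [← Finset.sum_add_distrib, ← Finset.sum_sub_distrib, Finset.mul_sum]
  refine Finset.sum_congr rfl fun j _ => ?_
  rw [sum_mul_christoffel hGs hx]
  ring

lemma matrixForm_symm {y : EuclideanSpace ℝ (Fin n)} (h : (G y).IsSymm) (v w : EuclideanSpace ℝ (Fin n)) :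
    matrixForm G y v w = matrixForm G y w v := by
  rw [matrixForm_apply, matrixForm_apply, Finset.sum_comm]
  refine Finset.sum_congr rfl fun i _ => Finset.sum_congr rfl fun j _ => ?_
  rw [h.apply]
  ring

lemma isParallelAt_christoffelForm (hG : ∀ i j, DifferentiableAt ℝ (fun u => G u i j) x)
    (hGs : ∀ᶠ u in 𝓝 x, (G u).IsSymm) (hx : (G x).det ≠ 0) :
    IsParallelAt (christoffelForm G) (matrixForm G) x := by
  intro z v w
  have hs : ∀ z v w, fderiv ℝ (matrixForm G) x z v w = fderiv ℝ (matrixForm G) x z w v := by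
    intro z v w
    rw [fderiv_matrixForm hG, fderiv_matrixForm hG]
    refine Finset.sum_congr rfl fun k _ => ?_
    rw [Finset.sum_comm]
    refine Finset.sum_congr rfl fun i _ => Finset.sum_congr rfl fun j _ => ?_
    rw [partialDeriv_symm hGs]
    ring
  rw [matrixForm_symm hGs.self_of_nhds v, matrixForm_christoffelForm hG hGs hx,
    matrixForm_christoffelForm hG hGs hx, hs z w v, hs w z v, hs v z w]
  ring

/-- This matches the index convention of the Ricci tensor with the invariant curvature operator,
sign included. The four identities `e1` to `e4` treat the four terms of the curvature, with the
`k`-th basis vector in the slot that is traced. -/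
lemma sum_ricciCoord_eq_trace (hG : ∀ k i j, DifferentiableAt ℝ (christoffel G k i j) x) (V : EuclideanSpace ℝ (Fin n))
    (K : EuclideanSpace ℝ (Fin n) →ₗ[ℝ] EuclideanSpace ℝ (Fin n)) (hK : ∀ z, K z = curvatureForm (christoffelForm G) x z V V) :
    ∑ l, ∑ j, ricciCoord G l j x * V l * V j = LinearMap.trace ℝ (EuclideanSpace ℝ (Fin n)) K := by
  rw [LinearMap.trace_eq_matrix_trace ℝ (EuclideanSpace.basisFun (Fin n) ℝ).toBasis]
  simp only [Matrix.trace, Matrix.diag, LinearMap.toMatrix_apply,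
    OrthonormalBasis.coe_toBasis, OrthonormalBasis.coe_toBasis_repr_apply,
    EuclideanSpace.basisFun_apply, EuclideanSpace.basisFun_repr, hK, ricciCoord, Finset.sum_mul]
  rw [Finset.sum_congr rfl fun l _ => Finset.sum_comm, Finset.sum_comm]
  refine Finset.sum_congr rfl fun k _ => ?_
  simp only [curvatureForm, PiLp.add_apply, PiLp.sub_apply, fderiv_christoffelForm hG,
    christoffelForm_apply]
  have e1 : ∑ i, ∑ j, fderiv ℝ (christoffel G k i j) x (EuclideanSpace.single k 1) * V i * V j
      = ∑ l, ∑ j, partialDeriv k (christoffel G k j l) x * V l * V j := by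
    rw [Finset.sum_comm]
    refine Finset.sum_congr rfl fun i _ => Finset.sum_congr rfl fun j _ => ?_
    rw [partialDeriv]
    ring
  have e2 : ∑ i, ∑ j, fderiv ℝ (christoffel G k i j) x V
        * (EuclideanSpace.single k (1 : ℝ) : EuclideanSpace ℝ (Fin n)) i * V j
      = ∑ l, ∑ j, partialDeriv j (christoffel G k k l) x * V l * V j := by
    rw [Finset.sum_eq_single k (fun b _ hb => by simp [hb]) (by simp)]
    refine Finset.sum_congr rfl fun l _ => ?_
    rw [fderiv_eq_sum_partialDeriv]
    simp only [PiLp.single_apply, if_true, mul_one, Finset.sum_mul]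
    exact Finset.sum_congr rfl fun j _ => by ring
  have e3 : ∑ i, ∑ m, christoffel G k i m x * (EuclideanSpace.single k (1 : ℝ) : EuclideanSpace ℝ (Fin n)) i
        * (∑ j, ∑ l, christoffel G m j l x * V j * V l)
      = ∑ l, ∑ j, (∑ m, christoffel G k k m x * christoffel G m j l x) * V l * V j := by
    rw [Finset.sum_eq_single k (fun b _ hb => by simp [hb]) (by simp)]
    simp only [PiLp.single_apply, if_true, mul_one, Finset.sum_mul, Finset.mul_sum]
    calc _ = ∑ m, ∑ l, ∑ j, christoffel G k k m x * (christoffel G m j l x * V j * V l) :=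
          Finset.sum_congr rfl fun m _ => Finset.sum_comm
      _ = _ := by
          rw [Finset.sum_comm]
          refine Finset.sum_congr rfl fun l _ => ?_
          rw [Finset.sum_comm]
          exact Finset.sum_congr rfl fun j _ => Finset.sum_congr rfl fun m _ => by ring
  have e4 : ∑ i, ∑ m, christoffel G k i m x * V i
        * (∑ j, ∑ l, christoffel G m j l x * (EuclideanSpace.single k (1 : ℝ) : EuclideanSpace ℝ (Fin n)) j * V l)
      = ∑ l, ∑ j, (∑ m, christoffel G k j m x * christoffel G m k l x) * V l * V j := by
    have : ∀ m, ∑ j, ∑ l, christoffel G m j l x * (EuclideanSpace.single k (1 : ℝ) : EuclideanSpace ℝ (Fin n)) j * V l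
        = ∑ l, christoffel G m k l x * V l := by
      intro m
      rw [Finset.sum_eq_single k (fun b _ hb => by simp [hb]) (by simp)]
      simp
    simp only [this, Finset.sum_mul, Finset.mul_sum]
    calc _ = ∑ j, ∑ l, ∑ m, christoffel G k j m x * V j * (christoffel G m k l x * V l) :=
          Finset.sum_congr rfl fun m _ => Finset.sum_comm
      _ = _ := by
          rw [Finset.sum_comm]
          exact Finset.sum_congr rfl fun l _ => Finset.sum_congr rfl fun j _ =>
            Finset.sum_congr rfl fun m _ => by ring
  rw [e1, e2, e3, e4, ← Finset.sum_sub_distrib, ← Finset.sum_add_distrib,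
    ← Finset.sum_sub_distrib]
  refine Finset.sum_congr rfl fun l _ => ?_
  rw [← Finset.sum_sub_distrib, ← Finset.sum_add_distrib, ← Finset.sum_sub_distrib]
  refine Finset.sum_congr rfl fun j _ => ?_
  rw [riemannCoord, Finset.sum_sub_distrib]
  ring

end Christoffel

/-! ### Null hypersurfaces in a Lorentzian vector space: second fundamental form, Weingarten map,
sign of the Ricci curvature. -/

section NullImmersion

open Filter Topology

set_option maxSynthPendingDepth 3

variable {D E : Type*} [NormedAddCommGroup D] [NormedSpace ℝ D]
  [NormedAddCommGroup E] [NormedSpace ℝ E]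

/-- The bilinear map underlying a continuous bilinear form. -/
noncomputable def bilinForm {T : Type*} [TopologicalSpace T] [AddCommGroup T] [Module ℝ T]
    (g : T →L[ℝ] T →L[ℝ] ℝ) : T →ₗ[ℝ] T →ₗ[ℝ] ℝ :=
  ContinuousLinearMap.coeLM ℝ ∘ₗ (g : T →ₗ[ℝ] T →L[ℝ] ℝ)

lemma bilinForm_apply {T : Type*} [TopologicalSpace T] [AddCommGroup T] [Module ℝ T]
    (g : T →L[ℝ] T →L[ℝ] ℝ) (v w : T) : bilinForm g v w = g v w := rfl

/-- Near the point with coordinates `u`, `F` is an immersion into a vector space with the Lorentzian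
metric `g`, and `Γ` is the Levi-Civita connection of `g`. -/
structure IsLorentzImmersionAt (Γ : E → E →L[ℝ] E →L[ℝ] E) (g : E → E →L[ℝ] E →L[ℝ] ℝ)
    (F : D → E) (u : D) : Prop where
  contDiffAt : ContDiffAt ℝ ∞ F u
  contDiffAt_metric : ContDiffAt ℝ ∞ g (F u)
  contDiffAt_christoffel : ContDiffAt ℝ ∞ Γ (F u)
  symm : ∀ᶠ y in 𝓝 (F u), ∀ v w, g y v w = g y w v
  torsion_free : ∀ v w, Γ (F u) v w = Γ (F u) w v
  parallel : ∀ᶠ y in 𝓝 (F u), IsParallelAt Γ g y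
  lorentz : ∃ t, g (F u) t t < 0 ∧ ∀ v, g (F u) t v = 0 → v ≠ 0 → 0 < g (F u) v v
  injective : Function.Injective (fderiv ℝ F u)

/-- `L` is a smooth field near `u` in the degeneracy directions of the pullback `F^* g`. -/
structure IsDegenerateFieldAt (g : E → E →L[ℝ] E →L[ℝ] ℝ) (F : D → E) (L : D → D) (u : D) :
    Prop where
  contDiffAt : ContDiffAt ℝ ∞ L u
  orthogonal : ∀ᶠ v in 𝓝 u, ∀ Y, g (F v) (fderiv ℝ F v (L v)) (fderiv ℝ F v Y) = 0

variable {Γ : E → E →L[ℝ] E →L[ℝ] E} {g : E → E →L[ℝ] E →L[ℝ] ℝ} {F : D → E} {L : D → D} {u : D}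

lemma IsLorentzImmersionAt.symm_self (h : IsLorentzImmersionAt Γ g F u) (v w : E) :
    g (F u) v w = g (F u) w v :=
  h.symm.self_of_nhds v w

lemma IsLorentzImmersionAt.differentiableAt (h : IsLorentzImmersionAt Γ g F u) :
    DifferentiableAt ℝ F u :=
  h.contDiffAt.differentiableAt (by simp)

lemma IsLorentzImmersionAt.differentiableAt_metric (h : IsLorentzImmersionAt Γ g F u) :
    DifferentiableAt ℝ g (F u) :=
  h.contDiffAt_metric.differentiableAt (by simp)

lemma IsLorentzImmersionAt.contDiffAt_fderiv (h : IsLorentzImmersionAt Γ g F u) :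
    ContDiffAt ℝ ∞ (fderiv ℝ F) u :=
  h.contDiffAt.fderiv_right (by simp)

lemma IsLorentzImmersionAt.differentiableAt_fderiv_apply (h : IsLorentzImmersionAt Γ g F u)
    {L : D → D} (hL : ContDiffAt ℝ ∞ L u) : DifferentiableAt ℝ (fun u => fderiv ℝ F u (L u)) u :=
  (h.contDiffAt_fderiv.clm_apply hL).differentiableAt (by simp)

lemma IsLorentzImmersionAt.covAlong_comm (h : IsLorentzImmersionAt Γ g F u) (X Y : D) :
    covAlong Γ F (fun u => fderiv ℝ F u Y) u X = covAlong Γ F (fun u => fderiv ℝ F u X) u Y :=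
  covAlong_fderiv_comm (h.contDiffAt.of_le ENat.LEInfty.out) h.torsion_free X Y

/-- The second fundamental form of a null hypersurface. -/
lemma IsDegenerateFieldAt.metric_covAlong (hL : IsDegenerateFieldAt g F L u)
    (h : IsLorentzImmersionAt Γ g F u) (X Y : D) :
    g (F u) (covAlong Γ F (fun u => fderiv ℝ F u (L u)) u X) (fderiv ℝ F u Y)
      = - g (F u) (fderiv ℝ F u (L u)) (covAlong Γ F (fun u => fderiv ℝ F u Y) u X) := by
  -- Differentiating this orthogonality moves the derivative off `L`. What results involves `L` only
  -- through its value at `u`, so the second fundamental form is tensorial in the null field.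
  have h0 : (fun v => g (F v) (fderiv ℝ F v (L v)) (fderiv ℝ F v Y)) =ᶠ[𝓝 u] fun _ => (0 : ℝ) :=
    hL.orthogonal.mono fun v hv => hv Y
  have h1 := fderiv_metric_apply h.differentiableAt_metric h.differentiableAt
    (h.differentiableAt_fderiv_apply hL.contDiffAt)
    (h.differentiableAt_fderiv_apply (contDiffAt_const (c := Y))) h.parallel.self_of_nhds X
  rw [h0.fderiv_eq] at h1
  simp only [fderiv_fun_const, Pi.zero_apply, zero_apply] at h1
  linarith

lemma IsDegenerateFieldAt.metric_covAlong_symm (hL : IsDegenerateFieldAt g F L u)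
    (h : IsLorentzImmersionAt Γ g F u) (X Y : D) :
    g (F u) (covAlong Γ F (fun u => fderiv ℝ F u (L u)) u X) (fderiv ℝ F u Y)
      = g (F u) (covAlong Γ F (fun u => fderiv ℝ F u (L u)) u Y) (fderiv ℝ F u X) := by
  rw [hL.metric_covAlong h, hL.metric_covAlong h, h.covAlong_comm]

/-- `∇ V` is tangent to the null cone. -/
lemma IsDegenerateFieldAt.metric_covAlong_self (hL : IsDegenerateFieldAt g F L u)
    (h : IsLorentzImmersionAt Γ g F u) (X : D) :
    g (F u) (fderiv ℝ F u (L u)) (covAlong Γ F (fun u => fderiv ℝ F u (L u)) u X) = 0 := by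
  have h0 : (fun v => g (F v) (fderiv ℝ F v (L v)) (fderiv ℝ F v (L v)))
      =ᶠ[𝓝 u] fun _ => (0 : ℝ) := hL.orthogonal.mono fun v hv => hv _
  have h1 := fderiv_metric_apply h.differentiableAt_metric h.differentiableAt
    (h.differentiableAt_fderiv_apply hL.contDiffAt)
    (h.differentiableAt_fderiv_apply hL.contDiffAt) h.parallel.self_of_nhds X
  rw [h0.fderiv_eq, h.symm_self (covAlong _ _ _ _ _)] at h1
  simp only [fderiv_fun_const, Pi.zero_apply, zero_apply] at h1
  linarith

/-- The Lie derivative of `F^* g` is twice the second fundamental form. -/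
lemma IsDegenerateFieldAt.lieDerivative (hL : IsDegenerateFieldAt g F L u)
    (h : IsLorentzImmersionAt Γ g F u) (X Y : D) :
    fderiv ℝ (fun u => g (F u) (fderiv ℝ F u X) (fderiv ℝ F u Y)) u (L u)
      + g (F u) (fderiv ℝ F u (fderiv ℝ L u X)) (fderiv ℝ F u Y)
      + g (F u) (fderiv ℝ F u X) (fderiv ℝ F u (fderiv ℝ L u Y))
      = 2 * g (F u) (covAlong Γ F (fun u => fderiv ℝ F u (L u)) u X) (fderiv ℝ F u Y) := by
  rw [fderiv_metric_apply h.differentiableAt_metric h.differentiableAt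
    (h.differentiableAt_fderiv_apply (contDiffAt_const (c := X)))
    (h.differentiableAt_fderiv_apply (contDiffAt_const (c := Y))) h.parallel.self_of_nhds,
    h.covAlong_comm (L u), h.covAlong_comm (L u)]
  have e : ∀ X, covAlong Γ F (fun u' => fderiv ℝ F u' (L u)) u X
      = covAlong Γ F (fun u => fderiv ℝ F u (L u)) u X - fderiv ℝ F u (fderiv ℝ L u X) := fun X => by
    rw [covAlong_fderiv_apply (h.contDiffAt.of_le ENat.LEInfty.out)
      (hL.contDiffAt.differentiableAt (by simp))]
    simp
  have e2 := hL.metric_covAlong_symm h X Y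
  rw [h.symm_self (covAlong Γ F (fun u => fderiv ℝ F u (L u)) u Y)] at e2
  rw [e, e]
  simp only [map_sub, sub_apply]
  linarith

variable [FiniteDimensional ℝ D] [FiniteDimensional ℝ E]

/-- Every tangent vector is orthogonal to the null vector `F_* L`, so the Lorentzian signature makes
the pulled back form positive definite modulo `L`. -/
lemma IsDegenerateFieldAt.exists_smul (hL : IsDegenerateFieldAt g F L u)
    (h : IsLorentzImmersionAt Γ g F u) (h0 : L u ≠ 0) (X : D)  :
    0 ≤ g (F u) (fderiv ℝ F u X) (fderiv ℝ F u X) ∧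
    (g (F u) (fderiv ℝ F u X) (fderiv ℝ F u X) = 0 → ∃ c : ℝ, X = c • L u) := by
  have hor := hL.orthogonal.self_of_nhds
  have h1 := lorentz_nonneg_of_orthogonal (bilinForm (g (F u))) h.symm_self h.lorentz
    (k := fderiv ℝ F u (L u)) (fun hz => h0 (h.injective (by rw [hz, map_zero])))
    (hor (L u)) (fderiv ℝ F u X) (hor X)
  refine ⟨h1.1, fun hX => ?_⟩
  obtain ⟨c, hc⟩ := h1.2 hX
  exact ⟨c, h.injective (by rw [hc, map_smul])⟩

/-- Existence of the Weingarten map `W`, `∇_X V = F_* (W X)`, with `W L = κ L`. -/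
lemma exists_weingarten (hdim : finrank ℝ E = finrank ℝ D + 1)
    (h : ∀ᶠ v in 𝓝 u, IsLorentzImmersionAt Γ g F v)
    (hL : ∀ᶠ v in 𝓝 u, IsDegenerateFieldAt g F L v) (h0 : L u ≠ 0) :
    ∃ (W : D → D →L[ℝ] D) (κ : D → ℝ), ContDiffAt ℝ ∞ W u ∧ ContDiffAt ℝ ∞ κ u ∧
      (∀ᶠ v in 𝓝 u, ∀ X, covAlong Γ F (fun u => fderiv ℝ F u (L u)) v X = fderiv ℝ F v (W v X)) ∧
      ∀ᶠ v in 𝓝 u, W v (L v) = κ v • L v := by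
  have hu := h.self_of_nhds
  have hLu := hL.self_of_nhds
  obtain ⟨P₀, hP₀⟩ := (fderiv ℝ F u : D →ₗ[ℝ] E).exists_leftInverse_of_injective
    (LinearMap.ker_eq_bot.2 hu.injective)
  let P : E →L[ℝ] D := LinearMap.toContinuousLinearMap P₀
  have hP : P ∘L fderiv ℝ F u = 1 := by
    ext X
    exact LinearMap.congr_fun hP₀ X
  obtain ⟨φ, -, hφ⟩ := exists_dual_vector ℝ (L u) (norm_ne_zero_iff.2 h0)
  let A : D → D →L[ℝ] D := fun v => P ∘L fderiv ℝ F v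
  let N : D → D →L[ℝ] E := fun v => fderiv ℝ (fun u => fderiv ℝ F u (L u)) v
    + (Γ (F v)).flip (fderiv ℝ F v (L v)) ∘L fderiv ℝ F v
  have hN : ∀ v X, N v X = covAlong Γ F (fun u => fderiv ℝ F u (L u)) v X := fun v X => rfl
  -- `P` is a left inverse of the derivative of `F` at `u` only. Near `u` the map `A v` is still
  -- invertible, so `(A v)⁻¹ P` is a left inverse at `v` that depends smoothly on `v`.
  let W : D → D →L[ℝ] D := fun v => Ring.inverse (A v) ∘L (P ∘L N v)
  have hdF := hu.contDiffAt_fderiv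
  have hV : ContDiffAt ℝ ∞ (fun u => fderiv ℝ F u (L u)) u := hdF.clm_apply hLu.contDiffAt
  have hA : ContDiffAt ℝ ∞ A u := contDiffAt_const.clm_comp hdF
  have hAu : A u = ((1 : (D →L[ℝ] D)ˣ) : D →L[ℝ] D) := hP
  have hAi : ContDiffAt ℝ ∞ (fun v => Ring.inverse (A v)) u := by
    have h1 : ContDiffAt ℝ ∞ Ring.inverse (A u) := by
      rw [hAu]
      exact contDiffAt_ringInverse ℝ _
    exact h1.comp u hA
  have hNs : ContDiffAt ℝ ∞ N u := by
    refine (hV.fderiv_right (by simp)).add (ContDiffAt.clm_comp ?_ hdF)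
    have h1 : ContDiffAt ℝ ∞ (fun v => Γ (F v)) u := hu.contDiffAt_christoffel.comp u hu.contDiffAt
    have h2 : ContDiffAt ℝ ∞ (fun v => (Γ (F v)).flip) u :=
      (ContinuousLinearMap.flipₗᵢ ℝ E E E).contDiff.contDiffAt.comp u h1
    exact h2.clm_apply hV
  have hWs : ContDiffAt ℝ ∞ W u := hAi.clm_comp (contDiffAt_const.clm_comp hNs)
  have hL0 : ∀ᶠ v in 𝓝 u, φ (L v) ≠ 0 := by
    have : ContinuousAt (fun v => φ (L v)) u :=
      φ.continuous.continuousAt.comp hLu.contDiffAt.continuousAt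
    refine this.eventually_ne ?_
    rw [hφ]
    simpa using h0
  have hunit : ∀ᶠ v in 𝓝 u, IsUnit (A v) := by
    refine hA.continuousAt.eventually (Units.isOpen.mem_nhds ?_)
    rw [hAu]
    exact Units.isUnit _
  have hWe : ∀ᶠ v in 𝓝 u, ∀ X,
      covAlong Γ F (fun u => fderiv ℝ F u (L u)) v X = fderiv ℝ F v (W v X) := by
    filter_upwards [h, hL, hL0, hunit] with v hv hLv hv0 hAv X
    have hmem := mem_range_of_orthogonal hdim (bilinForm (g (F v))) hv.symm_self hv.lorentz
      (fderiv ℝ F v : D →ₗ[ℝ] E) hv.injective (v := L v) (fun hz => hv0 (by rw [hz, map_zero]))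
      hLv.orthogonal.self_of_nhds (hLv.metric_covAlong_self hv X)
    obtain ⟨Z, hZ⟩ := hmem
    rw [← hZ]
    have h1 : W v X = Z := by
      change Ring.inverse (A v) (P (N v X)) = Z
      rw [hN, ← hZ]
      change (Ring.inverse (A v) * A v) Z = Z
      rw [Ring.inverse_mul_cancel _ hAv]
      rfl
    rw [h1]
    rfl
  refine ⟨W, fun v => φ (W v (L v)) / φ (L v), hWs, ?_, hWe, ?_⟩
  · exact (φ.contDiff.contDiffAt.comp u (hWs.clm_apply hLu.contDiffAt)).div
      (φ.contDiff.contDiffAt.comp u hLu.contDiffAt) hL0.self_of_nhds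
  · filter_upwards [h, hL, hL0, hWe] with v hv hLv hv0 hWv
    have hLv0 : L v ≠ 0 := fun hz => hv0 (by rw [hz, map_zero])
    -- By symmetry this equals `g(∇_{W L} V, V)`, which vanishes since `V` is null. A null tangent
    -- vector is a multiple of `L`; geometrically, the null generators are geodesics up to
    -- parametrisation.
    have h1 : g (F v) (fderiv ℝ F v (W v (L v))) (fderiv ℝ F v (W v (L v))) = 0 := by
      nth_rewrite 1 [← hWv]
      rw [hLv.metric_covAlong_symm hv, hv.symm_self]
      exact hLv.metric_covAlong_self hv _
    obtain ⟨c, hc⟩ := (hLv.exists_smul hv hLv0 _).2 h1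
    rw [hc]
    simp [hv0]

/-- The trace of the curvature operator of a non-expanding null field is non-positive, and it
vanishes only if the second fundamental form does. -/
lemma trace_curvature_nonpos (hdim : finrank ℝ E = finrank ℝ D + 1)
    (h : ∀ᶠ v in 𝓝 u, IsLorentzImmersionAt Γ g F v)
    (hL : ∀ᶠ v in 𝓝 u, IsDegenerateFieldAt g F L v) (h0 : L u ≠ 0)
    {W : D → D →L[ℝ] D} {κ : D → ℝ} (hW : ContDiffAt ℝ ∞ W u) (hκ : ContDiffAt ℝ ∞ κ u)
    (hWe : ∀ᶠ v in 𝓝 u, ∀ X,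
      covAlong Γ F (fun u => fderiv ℝ F u (L u)) v X = fderiv ℝ F v (W v X))
    (hWL : ∀ᶠ v in 𝓝 u, W v (L v) = κ v • L v)
    (hθ : ∀ᶠ v in 𝓝 u, LinearMap.trace ℝ D (W v : D →ₗ[ℝ] D) = κ v) (K : E →ₗ[ℝ] E)
    (hK : ∀ z, K z = curvatureForm Γ (F u) z (fderiv ℝ F u (L u)) (fderiv ℝ F u (L u))) :
    LinearMap.trace ℝ E K ≤ 0 ∧ (LinearMap.trace ℝ E K = 0 → ∀ X Y,
      g (F u) (covAlong Γ F (fun u => fderiv ℝ F u (L u)) u X) (fderiv ℝ F u Y) = 0) := by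
  have hu := h.self_of_nhds
  have hLu := hL.self_of_nhds
  have hor := hLu.orthogonal.self_of_nhds
  have hWu := hWe.self_of_nhds
  rw [trace_curvatureForm_eq (hu.contDiffAt.of_le ENat.LEInfty.out)
    (hLu.contDiffAt.of_le ENat.LEInfty.out) (hW.differentiableAt (by simp))
    (hκ.differentiableAt (by simp)) (hu.contDiffAt_christoffel.differentiableAt (by simp))
    hu.torsion_free hWe hWL hθ hu.injective K hK fun z => by
      rw [hK]
      refine mem_range_of_orthogonal hdim (bilinForm (g (F u))) hu.symm_self hu.lorentz
        (fderiv ℝ F u : D →ₗ[ℝ] E) hu.injective h0 hor ?_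
      rw [ContinuousLinearMap.coe_coe, bilinForm_apply, hu.symm_self]
      -- `g(R(z, V) V, V) = 0` says that `R(z, V) V` is orthogonal to `V` for every ambient `z`,
      -- hence tangent; this puts the whole trace on the hypersurface.
      exact metric_curvatureForm_self (hu.contDiffAt_metric.of_le ENat.LEInfty.out) hu.symm
        (hu.contDiffAt_christoffel.differentiableAt (by simp)) hu.parallel _ _ _]
  obtain ⟨φ, -, hφ⟩ := exists_dual_vector ℝ (L u) (norm_ne_zero_iff.2 h0)
  have hφ0 : φ (L u) ≠ 0 := by
    rw [hφ]
    simpa using h0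
  let q : D →ₗ[ℝ] D →ₗ[ℝ] ℝ :=
    (bilinForm (g (F u))).compl₁₂ (fderiv ℝ F u : D →ₗ[ℝ] E) (fderiv ℝ F u : D →ₗ[ℝ] E)
  have hq : ∀ X Y, q X Y = g (F u) (fderiv ℝ F u X) (fderiv ℝ F u Y) := fun _ _ => rfl
  have key := sq_le_trace_sq q (fun X Y => by rw [hq, hq, hu.symm_self]) (L u)
    (fun X => (hLu.exists_smul hu h0 X).1) (fun X => (hLu.exists_smul hu h0 X).2) hor
    (W u : D →ₗ[ℝ] D) (fun X Y => by
      rw [hq, hq, ContinuousLinearMap.coe_coe, ← hWu, ← hWu]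
      exact hLu.metric_covAlong_symm hu X Y)
    (κ := κ u) hWL.self_of_nhds ((φ (L u))⁻¹ • (φ : D →ₗ[ℝ] ℝ)) (by simp [hφ0])
  refine ⟨by linarith [key.1], fun ht X Y => ?_⟩
  rw [hWu]
  exact key.2 (by linarith) X Y

end NullImmersion

/-! ### Components of vectors, forms and fields in a chart of a manifold. -/

section Charts

open Filter Topology

set_option maxSynthPendingDepth 3

variable {n : ℕ} {M : Type*} [TopologicalSpace M] [ChartedSpace (EuclideanSpace ℝ (Fin n)) M]
  [IsManifold (𝓡 n) ∞ M]

/-- The tangent vector at the point with coordinates `u` with components `v`. -/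
noncomputable def coordLift (c : M) (u v : EuclideanSpace ℝ (Fin n)) :
    TangentSpace (𝓡 n) ((extChartAt (𝓡 n) c).symm u) :=
  mfderiv 𝓘(ℝ, EuclideanSpace ℝ (Fin n)) (𝓡 n) (extChartAt (𝓡 n) c).symm u v

lemma vecCoord_coordLift {c : M} {u : EuclideanSpace ℝ (Fin n)}
    (hu : u ∈ (extChartAt (𝓡 n) c).target) (v : EuclideanSpace ℝ (Fin n)) :
    vecCoord c ((extChartAt (𝓡 n) c).symm u) (coordLift c u v) = v := by
  have : IsManifold (𝓡 n) 1 M := IsManifold.of_le (n := ∞) (by simp)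
  have h := mfderiv_extChartAt_comp_mfderivWithin_extChartAt_symm (I := 𝓡 n) hu
  rw [ModelWithCorners.range_eq_univ, mfderivWithin_univ] at h
  exact DFunLike.congr_fun h v

lemma coordLift_vecCoord {c : M} {u : EuclideanSpace ℝ (Fin n)}
    (hu : u ∈ (extChartAt (𝓡 n) c).target)
    (v : TangentSpace (𝓡 n) ((extChartAt (𝓡 n) c).symm u)) :
    coordLift c u (vecCoord c ((extChartAt (𝓡 n) c).symm u) v) = v := by
  have : IsManifold (𝓡 n) 1 M := IsManifold.of_le (n := ∞) (by simp)
  have h := mfderivWithin_extChartAt_symm_comp_mfderiv_extChartAt (I := 𝓡 n) hu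
  rw [ModelWithCorners.range_eq_univ, mfderivWithin_univ] at h
  exact DFunLike.congr_fun h v

lemma coordLift_eq_sum (c : M) (u v : EuclideanSpace ℝ (Fin n)) :
    coordLift c u v = ∑ i, v i • coordVec c u i := by
  conv_lhs => rw [← (EuclideanSpace.basisFun (Fin n) ℝ).sum_repr v]
  change mfderiv 𝓘(ℝ, EuclideanSpace ℝ (Fin n)) (𝓡 n) (extChartAt (𝓡 n) c).symm u
    (∑ i, v i • EuclideanSpace.basisFun (Fin n) ℝ i) = _
  refine (map_sum (mfderiv 𝓘(ℝ, EuclideanSpace ℝ (Fin n)) (𝓡 n) (extChartAt (𝓡 n) c).symm u) _ _).trans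
    (Finset.sum_congr rfl fun i _ => ?_)
  refine (map_smul (mfderiv 𝓘(ℝ, EuclideanSpace ℝ (Fin n)) (𝓡 n) (extChartAt (𝓡 n) c).symm u) _ _).trans ?_
  rw [EuclideanSpace.basisFun_apply]
  rfl

lemma matrixForm_formCoord (h : ∀ x : M, TangentSpace (𝓡 n) x →L[ℝ] TangentSpace (𝓡 n) x →L[ℝ] ℝ)
    (c : M) (u v w : EuclideanSpace ℝ (Fin n)) :
    matrixForm (formCoord h c) u v w
      = h ((extChartAt (𝓡 n) c).symm u) (coordLift c u v) (coordLift c u w) := by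
  rw [matrixForm_apply, coordLift_eq_sum, coordLift_eq_sum]
  simp only [map_sum, map_smul, sum_apply, smul_apply, smul_eq_mul, Finset.mul_sum]
  rw [Finset.sum_comm]
  refine Finset.sum_congr rfl fun i _ => Finset.sum_congr rfl fun j _ => ?_
  simp only [formCoord, Matrix.of_apply]
  ring

lemma matrixForm_formCoord_vecCoord
    (h : ∀ x : M, TangentSpace (𝓡 n) x →L[ℝ] TangentSpace (𝓡 n) x →L[ℝ] ℝ)
    {c x : M} (hx : x ∈ (extChartAt (𝓡 n) c).source) (v w : TangentSpace (𝓡 n) x) :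
    matrixForm (formCoord h c) (extChartAt (𝓡 n) c x) (vecCoord c x v) (vecCoord c x w)
      = h x v w := by
  obtain ⟨u, hu, rfl⟩ : ∃ u ∈ (extChartAt (𝓡 n) c).target, (extChartAt (𝓡 n) c).symm u = x :=
    ⟨_, (extChartAt (𝓡 n) c).map_source hx, (extChartAt (𝓡 n) c).left_inv hx⟩
  rw [(extChartAt (𝓡 n) c).right_inv hu, matrixForm_formCoord, coordLift_vecCoord hu,
    coordLift_vecCoord hu]

lemma contMDiffAt_coordLift {c : M} {u : EuclideanSpace ℝ (Fin n)}
    (hu : u ∈ (extChartAt (𝓡 n) c).target) (v : EuclideanSpace ℝ (Fin n)) :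
    ContMDiffAt 𝓘(ℝ, EuclideanSpace ℝ (Fin n)) (𝓡 n).tangent ∞
      (fun u => (⟨(extChartAt (𝓡 n) c).symm u, coordLift c u v⟩ : TangentBundle (𝓡 n) M)) u := by
  have ho : IsOpen (extChartAt (𝓡 n) c).target := isOpen_extChartAt_target c
  have h1 := (contMDiffOn_extChartAt_symm (I := 𝓡 n) (n := ∞) c).contMDiffOn_tangentMapWithin
    (m := ∞) (by simp) ho.uniqueMDiffOn
  have h2 : ContMDiffOn 𝓘(ℝ, EuclideanSpace ℝ (Fin n)) 𝓘(ℝ, EuclideanSpace ℝ (Fin n)).tangent ∞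
      (fun u => (⟨u, v⟩ : TangentBundle 𝓘(ℝ, EuclideanSpace ℝ (Fin n)) (EuclideanSpace ℝ (Fin n))))
      (extChartAt (𝓡 n) c).target :=
    contMDiffOn_vectorSpace_iff_contDiffOn.2 contDiffOn_const
  have h3 := (h1.comp h2 fun u hu => hu).contMDiffAt (ho.mem_nhds hu)
  refine h3.congr_of_eventuallyEq ?_
  filter_upwards [ho.mem_nhds hu] with w hw
  simp only [Function.comp_apply, tangentMapWithin, coordLift,
    mfderivWithin_of_isOpen ho hw]

lemma contDiffAt_formCoord {h : ∀ x : M, TangentSpace (𝓡 n) x →L[ℝ] TangentSpace (𝓡 n) x →L[ℝ] ℝ}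
    (hh : ContMDiff (𝓡 n)
      ((𝓡 n).prod 𝓘(ℝ, EuclideanSpace ℝ (Fin n) →L[ℝ] EuclideanSpace ℝ (Fin n) →L[ℝ] ℝ)) ∞
      (fun x => TotalSpace.mk' (EuclideanSpace ℝ (Fin n) →L[ℝ] EuclideanSpace ℝ (Fin n) →L[ℝ] ℝ)
        (E := fun x : M => TangentSpace (𝓡 n) x →L[ℝ] TangentSpace (𝓡 n) x →L[ℝ] ℝ) x (h x)))
    {c : M} {u : EuclideanSpace ℝ (Fin n)}
    (hu : u ∈ (extChartAt (𝓡 n) c).target) (i j : Fin n) :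
    ContDiffAt ℝ ∞ (fun u => formCoord h c u i j) u := by
  rw [← contMDiffAt_iff_contDiffAt]
  have ho : IsOpen (extChartAt (𝓡 n) c).target := isOpen_extChartAt_target c
  have hb : ContMDiffAt 𝓘(ℝ, EuclideanSpace ℝ (Fin n)) (𝓡 n) ∞ (extChartAt (𝓡 n) c).symm u :=
    (contMDiffOn_extChartAt_symm (I := 𝓡 n) (n := ∞) c).contMDiffAt (ho.mem_nhds hu)
  have : ContMDiffAt 𝓘(ℝ, EuclideanSpace ℝ (Fin n)) ((𝓡 n).prod 𝓘(ℝ)) ∞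
      (fun u => TotalSpace.mk' ℝ (E := Bundle.Trivial M ℝ) ((extChartAt (𝓡 n) c).symm u)
        (h ((extChartAt (𝓡 n) c).symm u) (coordLift c u (EuclideanSpace.single i 1))
          (coordLift c u (EuclideanSpace.single j 1)))) u := by
    apply ContMDiffAt.clm_bundle_apply₂ (F₁ := EuclideanSpace ℝ (Fin n))
      (F₂ := EuclideanSpace ℝ (Fin n))
    · exact hh.contMDiffAt.comp u hb
    · exact contMDiffAt_coordLift hu _
    · exact contMDiffAt_coordLift hu _
  rw [contMDiffAt_totalSpace] at this
  exact this.2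

lemma contDiffAt_vecCoord {c : M} {u : EuclideanSpace ℝ (Fin n)}
    (hu : u ∈ (extChartAt (𝓡 n) c).target) {ℓ : ∀ x : M, TangentSpace (𝓡 n) x}
    (hℓ : ContMDiffAt (𝓡 n) (𝓡 n).tangent ∞ (fun x => (⟨x, ℓ x⟩ : TangentBundle (𝓡 n) M))
      ((extChartAt (𝓡 n) c).symm u)) :
    ContDiffAt ℝ ∞ (fun w => vecCoord c ((extChartAt (𝓡 n) c).symm w)
      (ℓ ((extChartAt (𝓡 n) c).symm w))) u := by
  rw [← contMDiffAt_iff_contDiffAt]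
  have ho : IsOpen (extChartAt (𝓡 n) c).target := isOpen_extChartAt_target c
  have hs : IsOpen (chartAt (EuclideanSpace ℝ (Fin n)) c).source :=
    (chartAt (EuclideanSpace ℝ (Fin n)) c).open_source
  have hb : ContMDiffAt 𝓘(ℝ, EuclideanSpace ℝ (Fin n)) (𝓡 n) ∞ (extChartAt (𝓡 n) c).symm u :=
    (contMDiffOn_extChartAt_symm (I := 𝓡 n) (n := ∞) c).contMDiffAt (ho.mem_nhds hu)
  have hmap : ∀ w ∈ (extChartAt (𝓡 n) c).target, (extChartAt (𝓡 n) c).symm w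
      ∈ (chartAt (EuclideanSpace ℝ (Fin n)) c).source := fun w hw => by
    rw [← extChartAt_source (I := 𝓡 n)]
    exact (extChartAt (𝓡 n) c).map_target hw
  have h1 := (contMDiffOn_extChartAt (I := 𝓡 n) (n := ∞) (x := c)).contMDiffOn_tangentMapWithin
    (m := ∞) (by simp) hs.uniqueMDiffOn
  have h1' := h1.contMDiffAt (x := (⟨(extChartAt (𝓡 n) c).symm u, ℓ _⟩ : TangentBundle (𝓡 n) M))
    ((hs.preimage (FiberBundle.continuous_proj _ _)).mem_nhds (hmap u hu))
  have h2 := h1'.comp u (hℓ.comp u hb)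
  have h3 := (contMDiff_snd_tangentBundle_modelSpace (EuclideanSpace ℝ (Fin n)) (n := ∞)
    𝓘(ℝ, EuclideanSpace ℝ (Fin n))).contMDiffAt.comp u h2
  refine h3.congr_of_eventuallyEq ?_
  filter_upwards [ho.mem_nhds hu] with w hw
  change mfderiv _ _ _ _ _ = mfderivWithin _ _ _ _ _ _
  rw [mfderivWithin_of_isOpen hs (hmap w hw)]
  rfl

end Charts

/-! ### The immersion and the metric in charts. -/

section Hypersurface

open Filter Topology

set_option maxSynthPendingDepth 3

variable {n d : ℕ} {M : Type*} [TopologicalSpace M] [ChartedSpace (EuclideanSpace ℝ (Fin n)) M]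
  [IsManifold (𝓡 n) ∞ M] {S : Type*} [TopologicalSpace S]
  [ChartedSpace (EuclideanSpace ℝ (Fin d)) S] [IsManifold (𝓡 d) ∞ S]

variable (n d) in
/-- The map `ι` in the preferred charts around `p₀` and `c`. -/
noncomputable def chartMap (ι : S → M) (c : M) (p₀ : S) (u : EuclideanSpace ℝ (Fin d)) :
    EuclideanSpace ℝ (Fin n) :=
  extChartAt (𝓡 n) c (ι ((extChartAt (𝓡 d) p₀).symm u))

variable (n d) in
/-- The coordinates at which the map `ι` can be written in the preferred charts around `p₀` and
`c`. -/
def chartDomain (ι : S → M) (c : M) (p₀ : S) : Set (EuclideanSpace ℝ (Fin d)) :=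
  (extChartAt (𝓡 d) p₀).target ∩
    (extChartAt (𝓡 d) p₀).symm ⁻¹' (ι ⁻¹' (extChartAt (𝓡 n) c).source)

variable {ι : S → M} {c : M} {p₀ : S} {u : EuclideanSpace ℝ (Fin d)}

lemma contMDiffAt_extChartAt_symm (hu : u ∈ (extChartAt (𝓡 d) p₀).target) :
    ContMDiffAt 𝓘(ℝ, EuclideanSpace ℝ (Fin d)) (𝓡 d) ∞ (extChartAt (𝓡 d) p₀).symm u :=
  (contMDiffOn_extChartAt_symm (I := 𝓡 d) (n := ∞) p₀).contMDiffAt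
    ((isOpen_extChartAt_target (I := 𝓡 d) p₀).mem_nhds hu)

lemma isOpen_chartDomain (hι : Continuous ι) (c : M) (p₀ : S) : IsOpen (chartDomain n d ι c p₀) :=
  (continuousOn_extChartAt_symm p₀).isOpen_inter_preimage (isOpen_extChartAt_target (I := 𝓡 d) p₀)
    ((isOpen_extChartAt_source (I := 𝓡 n) c).preimage hι)

lemma mem_chartDomain {p : S} (hp : p ∈ (extChartAt (𝓡 d) p₀).source)
    (hc : ι p ∈ (extChartAt (𝓡 n) c).source) : extChartAt (𝓡 d) p₀ p ∈ chartDomain n d ι c p₀ := by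
  refine ⟨(extChartAt (𝓡 d) p₀).map_source hp, ?_⟩
  rwa [mem_preimage, (extChartAt (𝓡 d) p₀).left_inv hp]

lemma contMDiffAt_extChartAt_comp (hι : ContMDiff (𝓡 d) (𝓡 n) ∞ ι)
    (hu : u ∈ chartDomain n d ι c p₀) :
    ContMDiffAt 𝓘(ℝ, EuclideanSpace ℝ (Fin d)) 𝓘(ℝ, EuclideanSpace ℝ (Fin n)) ∞
      (chartMap n d ι c p₀) u := by
  have h2 : ContMDiffAt (𝓡 n) 𝓘(ℝ, EuclideanSpace ℝ (Fin n)) ∞ (extChartAt (𝓡 n) c)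
      (ι ((extChartAt (𝓡 d) p₀).symm u)) :=
    contMDiffAt_extChartAt' (by rw [← extChartAt_source (I := 𝓡 n)]; exact hu.2)
  exact h2.comp u (hι.contMDiffAt.comp u (contMDiffAt_extChartAt_symm hu.1))

lemma contDiffAt_chartMap (hι : ContMDiff (𝓡 d) (𝓡 n) ∞ ι) (hu : u ∈ chartDomain n d ι c p₀) :
    ContDiffAt ℝ ∞ (chartMap n d ι c p₀) u :=
  (contMDiffAt_extChartAt_comp hι hu).contDiffAt

lemma fderiv_chartMap (hι : ContMDiff (𝓡 d) (𝓡 n) ∞ ι) (hu : u ∈ chartDomain n d ι c p₀)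
    (X : EuclideanSpace ℝ (Fin d)) :
    fderiv ℝ (chartMap n d ι c p₀) u X = vecCoord c (ι ((extChartAt (𝓡 d) p₀).symm u))
      (mfderiv (𝓡 d) (𝓡 n) ι ((extChartAt (𝓡 d) p₀).symm u) (coordLift p₀ u X)) := by
  have h1 : MDifferentiableAt 𝓘(ℝ, EuclideanSpace ℝ (Fin d)) (𝓡 d) (extChartAt (𝓡 d) p₀).symm u :=
    (contMDiffAt_extChartAt_symm hu.1).mdifferentiableAt (by simp)
  have h2 : MDifferentiableAt (𝓡 d) (𝓡 n) ι ((extChartAt (𝓡 d) p₀).symm u) :=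
    hι.contMDiffAt.mdifferentiableAt (by simp)
  have h3 : MDifferentiableAt (𝓡 n) 𝓘(ℝ, EuclideanSpace ℝ (Fin n)) (extChartAt (𝓡 n) c)
      (ι ((extChartAt (𝓡 d) p₀).symm u)) :=
    (contMDiffAt_extChartAt' (n := ∞)
      (by rw [← extChartAt_source (I := 𝓡 n)]; exact hu.2)).mdifferentiableAt (by simp)
  have h := (h3.hasMFDerivAt.comp u (h2.hasMFDerivAt.comp u h1.hasMFDerivAt)).mfderiv
  have h' : fderiv ℝ (chartMap n d ι c p₀) u = _ := (mfderiv_eq_fderiv).symm.trans h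
  rw [h']
  rfl

lemma fderiv_chartMap_vecCoord (hι : ContMDiff (𝓡 d) (𝓡 n) ∞ ι) {p : S}
    (hp : p ∈ (extChartAt (𝓡 d) p₀).source) (hc : ι p ∈ (extChartAt (𝓡 n) c).source)
    (X : TangentSpace (𝓡 d) p) :
    fderiv ℝ (chartMap n d ι c p₀) (extChartAt (𝓡 d) p₀ p) (vecCoord p₀ p X)
      = vecCoord c (ι p) (mfderiv (𝓡 d) (𝓡 n) ι p X) := by
  obtain ⟨u, hu, rfl⟩ : ∃ u ∈ (extChartAt (𝓡 d) p₀).target, (extChartAt (𝓡 d) p₀).symm u = p :=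
    ⟨_, (extChartAt (𝓡 d) p₀).map_source hp, (extChartAt (𝓡 d) p₀).left_inv hp⟩
  rw [(extChartAt (𝓡 d) p₀).right_inv hu, fderiv_chartMap hι ⟨hu, hc⟩, coordLift_vecCoord hu]

namespace LorentzMetric

variable (g : LorentzMetric n M)

/-- The metric in the preferred chart around `c`. -/
noncomputable def metricCoord (c : M) :
    EuclideanSpace ℝ (Fin n) → EuclideanSpace ℝ (Fin n) →L[ℝ] EuclideanSpace ℝ (Fin n) →L[ℝ] ℝ :=
  matrixForm (formCoord g.val c)

/-- The Levi-Civita connection in the preferred chart around `c`. -/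
noncomputable def connectionCoord (c : M) :
    EuclideanSpace ℝ (Fin n) → EuclideanSpace ℝ (Fin n) →L[ℝ] EuclideanSpace ℝ (Fin n) →L[ℝ]
      EuclideanSpace ℝ (Fin n) :=
  christoffelForm (formCoord g.val c)

lemma formCoord_isSymm (c : M) (u : EuclideanSpace ℝ (Fin n)) : (formCoord g.val c u).IsSymm := by
  ext i j
  exact g.symm _ _ _

lemma lorentz_metricCoord {c : M} {x : EuclideanSpace ℝ (Fin n)}
    (hx : x ∈ (extChartAt (𝓡 n) c).target) :
    ∃ t, g.metricCoord c x t t < 0 ∧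
      ∀ v, g.metricCoord c x t v = 0 → v ≠ 0 → 0 < g.metricCoord c x v v := by
  obtain ⟨t, ht, h⟩ := g.lorentzian ((extChartAt (𝓡 n) c).symm x)
  have e : ∀ v w, g.metricCoord c x v w = g.val _ (coordLift c x v) (coordLift c x w) :=
    fun v w => matrixForm_formCoord _ _ _ _ _
  refine ⟨vecCoord c _ t, ?_, fun v hv hv0 => ?_⟩
  · rw [e, coordLift_vecCoord hx]
    exact ht
  · rw [e, coordLift_vecCoord hx] at hv
    rw [e]
    refine h _ hv fun h0 => hv0 ?_
    rw [← vecCoord_coordLift hx v, h0]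
    exact map_zero (mfderiv (𝓡 n) 𝓘(ℝ, EuclideanSpace ℝ (Fin n)) (extChartAt (𝓡 n) c)
      ((extChartAt (𝓡 n) c).symm x))

lemma det_formCoord_ne_zero {c : M} {x : EuclideanSpace ℝ (Fin n)}
    (hx : x ∈ (extChartAt (𝓡 n) c).target) : (formCoord g.val c x).det ≠ 0 := by
  intro h0
  obtain ⟨v, hv0, hv⟩ := Matrix.exists_mulVec_eq_zero_iff.2 h0
  have hs : ∀ v w, g.metricCoord c x v w = g.metricCoord c x w v :=
    matrixForm_symm (g.formCoord_isSymm c x)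
  have hz := lorentz_nondegenerate (bilinForm (g.metricCoord c x)) hs
    (g.lorentz_metricCoord hx) (v := WithLp.toLp 2 v) fun w => by
      rw [bilinForm_apply, hs, metricCoord, matrixForm_apply]
      refine Finset.sum_eq_zero fun i _ => ?_
      have := congrFun hv i
      simp only [Matrix.mulVec, dotProduct, Pi.zero_apply] at this
      rw [← mul_zero (w i), ← this, Finset.mul_sum]
      exact Finset.sum_congr rfl fun j _ => by ring
  apply hv0
  exact congrArg WithLp.ofLp hz

/-- The bridge from manifolds to the vector space calculus. The chart `c` stays fixed while `u`
ranges over an open set, because the curvature computations differentiate identities that hold near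
a point. -/
lemma isLorentzImmersionAt_chartMap (hι : ContMDiff (𝓡 d) (𝓡 n) ∞ ι)
    (hinj : ∀ p, Function.Injective (mfderiv (𝓡 d) (𝓡 n) ι p)) (hu : u ∈ chartDomain n d ι c p₀) :
    IsLorentzImmersionAt (g.connectionCoord c) (g.metricCoord c) (chartMap n d ι c p₀) u := by
  have hx : chartMap n d ι c p₀ u ∈ (extChartAt (𝓡 n) c).target := (extChartAt (𝓡 n) c).map_source hu.2
  have hnhds := (isOpen_extChartAt_target (I := 𝓡 n) c).mem_nhds hx
  have hG : ∀ x ∈ (extChartAt (𝓡 n) c).target, ∀ i j,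
      ContDiffAt ℝ ∞ (fun u => formCoord g.val c u i j) x := fun x hx i j =>
    contDiffAt_formCoord g.contMDiff hx i j
  have hGs : ∀ x, ∀ᶠ y in 𝓝 x, (formCoord g.val c y).IsSymm := fun x =>
    Eventually.of_forall fun y => g.formCoord_isSymm c y
  exact
    { contDiffAt := contDiffAt_chartMap hι hu
      contDiffAt_metric := contDiffAt_matrixForm (hG _ hx)
      contDiffAt_christoffel := contDiffAt_christoffelForm (hG _ hx) (by simp)
        (g.det_formCoord_ne_zero hx)
      symm := Eventually.of_forall fun y => matrixForm_symm (g.formCoord_isSymm c y)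
      torsion_free := christoffelForm_symm (hGs _)
      parallel := by
        filter_upwards [hnhds] with y hy
        exact isParallelAt_christoffelForm (fun i j => (hG y hy i j).differentiableAt (by simp))
          (hGs y) (g.det_formCoord_ne_zero hy)
      lorentz := g.lorentz_metricCoord hx
      injective := by
        have : IsManifold (𝓡 n) 1 M := IsManifold.of_le (n := ∞) (by simp)
        intro X Y hXY
        rw [fderiv_chartMap hι hu, fderiv_chartMap hι hu] at hXY
        have h1 := hinj _ ((isInvertible_mfderiv_extChartAt (I := 𝓡 n) hu.2).injective hXY)
        rw [← vecCoord_coordLift hu.1 X, h1, vecCoord_coordLift hu.1] }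

lemma metricCoord_chartMap_vecCoord (hι : ContMDiff (𝓡 d) (𝓡 n) ∞ ι) {p : S}
    (hp : p ∈ (extChartAt (𝓡 d) p₀).source) (hc : ι p ∈ (extChartAt (𝓡 n) c).source)
    (X Y : TangentSpace (𝓡 d) p) :
    g.metricCoord c (chartMap n d ι c p₀ (extChartAt (𝓡 d) p₀ p))
      (fderiv ℝ (chartMap n d ι c p₀) (extChartAt (𝓡 d) p₀ p) (vecCoord p₀ p X))
      (fderiv ℝ (chartMap n d ι c p₀) (extChartAt (𝓡 d) p₀ p) (vecCoord p₀ p Y))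
      = g.induced ι p X Y := by
  rw [fderiv_chartMap_vecCoord hι hp hc, fderiv_chartMap_vecCoord hι hp hc, induced_apply,
    chartMap, (extChartAt (𝓡 d) p₀).left_inv hp]
  exact matrixForm_formCoord_vecCoord g.val hc _ _

/-- The induced metric in coordinates. -/
lemma metricCoord_chartMap (hι : ContMDiff (𝓡 d) (𝓡 n) ∞ ι) (hu : u ∈ chartDomain n d ι c p₀)
    (X Y : EuclideanSpace ℝ (Fin d)) :
    g.metricCoord c (chartMap n d ι c p₀ u) (fderiv ℝ (chartMap n d ι c p₀) u X)
      (fderiv ℝ (chartMap n d ι c p₀) u Y) = matrixForm (formCoord (g.induced ι) p₀) u X Y := by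
  have hs := (extChartAt (𝓡 d) p₀).map_target hu.1
  have h := g.metricCoord_chartMap_vecCoord (c := c) hι hs hu.2 (coordLift p₀ u X)
    (coordLift p₀ u Y)
  rw [(extChartAt (𝓡 d) p₀).right_inv hu.1, vecCoord_coordLift hu.1,
    vecCoord_coordLift hu.1] at h
  rw [h, matrixForm_formCoord]

end LorentzMetric

end Hypersurface

/-! ### The tensor `∇_a ℓ_b` in charts, its tensoriality, and the Lie derivative of the induced
metric. -/

section Derivative

open Filter Topology

set_option maxSynthPendingDepth 3

lemma sum_lieDerivative_eq {d : ℕ} {H : EuclideanSpace ℝ (Fin d) → Matrix (Fin d) (Fin d) ℝ}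
    {L : EuclideanSpace ℝ (Fin d) → EuclideanSpace ℝ (Fin d)} {u : EuclideanSpace ℝ (Fin d)}
    (hH : ∀ i j, DifferentiableAt ℝ (fun u => H u i j) u) (hL : DifferentiableAt ℝ L u)
    (X Y : EuclideanSpace ℝ (Fin d)) :
    ∑ a, ∑ b, (∑ c, (L u c * partialDeriv c (fun w => H w a b) u
      + H u c b * partialDeriv a (fun w => L w c) u
      + H u a c * partialDeriv b (fun w => L w c) u)) * X a * Y b
      = fderiv ℝ (fun w => matrixForm H w X Y) u (L u) + matrixForm H u (fderiv ℝ L u X) Y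
        + matrixForm H u X (fderiv ℝ L u Y) := by
  have hH' : DifferentiableAt ℝ (matrixForm H) u :=
    DifferentiableAt.fun_sum fun i _ => DifferentiableAt.fun_sum fun j _ =>
      (hH i j).smul_const _
  have h1 : fderiv ℝ (fun w => matrixForm H w X Y) u (L u)
      = fderiv ℝ (matrixForm H) u (L u) X Y := by
    rw [((hH'.hasFDerivAt.clm_apply (hasFDerivAt_const X u)).clm_apply
      (hasFDerivAt_const Y u)).fderiv]
    simp
  have h2 : ∀ X c, fderiv ℝ L u X c = ∑ a, X a * partialDeriv a (fun w => L w c) u := by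
    intro X c
    rw [← fderiv_eq_sum_partialDeriv]
    have h3 : HasFDerivAt (fun w => L w c) ((EuclideanSpace.proj c : _ →L[ℝ] ℝ) ∘L fderiv ℝ L u) u :=
      (EuclideanSpace.proj c : EuclideanSpace ℝ (Fin d) →L[ℝ] ℝ).hasFDerivAt.comp u hL.hasFDerivAt
    rw [h3.fderiv]
    rfl
  rw [h1, fderiv_matrixForm hH, matrixForm_apply, matrixForm_apply]
  simp only [h2, Finset.sum_add_distrib, add_mul, Finset.sum_mul, Finset.mul_sum]
  congr 1
  · congr 1
    · rw [Finset.sum_congr rfl fun a _ => Finset.sum_comm, Finset.sum_comm]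
      exact Finset.sum_congr rfl fun _ _ => Finset.sum_congr rfl fun _ _ =>
        Finset.sum_congr rfl fun _ _ => by ring
    · rw [Finset.sum_congr rfl fun a _ => Finset.sum_comm, Finset.sum_comm]
      refine Finset.sum_congr rfl fun c _ => ?_
      rw [Finset.sum_comm]
      exact Finset.sum_congr rfl fun _ _ => Finset.sum_congr rfl fun _ _ => by ring
  · refine Finset.sum_congr rfl fun a _ => ?_
    rw [Finset.sum_comm]
    exact Finset.sum_congr rfl fun _ _ => Finset.sum_congr rfl fun _ _ => by ring

variable {n d : ℕ} {M : Type*} [TopologicalSpace M] [ChartedSpace (EuclideanSpace ℝ (Fin n)) M]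
  [IsManifold (𝓡 n) ∞ M] {S : Type*} [TopologicalSpace S]
  [ChartedSpace (EuclideanSpace ℝ (Fin d)) S] [IsManifold (𝓡 d) ∞ S]

/-- The components of a vector field in the preferred chart around `c`. -/
noncomputable def fieldCoord (c : S) (ℓ : ∀ p : S, TangentSpace (𝓡 d) p)
    (w : EuclideanSpace ℝ (Fin d)) : EuclideanSpace ℝ (Fin d) :=
  vecCoord c ((extChartAt (𝓡 d) c).symm w) (ℓ ((extChartAt (𝓡 d) c).symm w))

lemma fieldCoord_extChartAt {c p : S} (hp : p ∈ (extChartAt (𝓡 d) c).source)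
    (ℓ : ∀ p : S, TangentSpace (𝓡 d) p) :
    fieldCoord c ℓ (extChartAt (𝓡 d) c p) = vecCoord c p (ℓ p) :=
  congrArg (fun q => vecCoord c q (ℓ q)) ((extChartAt (𝓡 d) c).left_inv hp)

lemma vecCoord_eq_zero_iff {c p : S} (hp : p ∈ (extChartAt (𝓡 d) c).source)
    (v : TangentSpace (𝓡 d) p) : vecCoord c p v = 0 ↔ v = 0 := by
  have : IsManifold (𝓡 d) 1 S := IsManifold.of_le (n := ∞) (by simp)
  exact map_eq_zero_iff (mfderiv (𝓡 d) 𝓘(ℝ, EuclideanSpace ℝ (Fin d)) (extChartAt (𝓡 d) c) p)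
    (isInvertible_mfderiv_extChartAt (I := 𝓡 d) hp).injective

lemma vecCoord_smul (c p : S) (r : ℝ) (v : TangentSpace (𝓡 d) p) :
    vecCoord c p (r • v) = r • vecCoord c p v :=
  map_smul (mfderiv (𝓡 d) 𝓘(ℝ, EuclideanSpace ℝ (Fin d)) (extChartAt (𝓡 d) c) p) r v

namespace LorentzMetric

variable {g : LorentzMetric n M} {ι : S → M} {c : M} {p₀ : S} {u : EuclideanSpace ℝ (Fin d)}

/-- Tangent vectors are orthogonal to the null image of a degeneracy vector `k`, so by the signature
every null tangent vector is a multiple of `k`. In particular the null directions form a single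
line. -/
lemma IsNullSurface.exists_smul (hS : g.IsNullSurface (d := d) ι) {p : S}
    {v w : TangentSpace (𝓡 d) p} (hv : v ≠ 0) (hvv : g.induced ι p v v = 0)
    (hww : g.induced ι p w w = 0) : ∃ r : ℝ, w = r • v := by
  obtain ⟨k, hk, hkd⟩ := hS.degenerate p
  have key : ∀ x : TangentSpace (𝓡 d) p, g.induced ι p x x = 0 → ∃ r : ℝ, x = r • k := by
    intro x hx
    obtain ⟨r, hr⟩ := (lorentz_nonneg_of_orthogonal (bilinForm (g.val (ι p))) (g.symm _)
      (g.lorentzian _) (k := mfderiv (𝓡 d) (𝓡 n) ι p k)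
      (fun h => hk (hS.injective_mfderiv p (by rw [h, map_zero]))) (hkd k)
      (mfderiv (𝓡 d) (𝓡 n) ι p x) (hkd x)).2 hx
    exact ⟨r, hS.injective_mfderiv p (by rw [hr, map_smul])⟩
  obtain ⟨a, ha⟩ := key v hvv
  obtain ⟨b, hb⟩ := key w hww
  have ha0 : a ≠ 0 := fun h => hv (by rw [ha, h, zero_smul])
  exact ⟨b / a, by rw [ha, hb, smul_smul, div_mul_cancel₀ _ ha0]⟩

lemma IsNullSurface.induced_eq_zero (hS : g.IsNullSurface (d := d) ι) {p : S}
    {v : TangentSpace (𝓡 d) p} (hvv : g.induced ι p v v = 0) (w : TangentSpace (𝓡 d) p) :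
    g.induced ι p v w = 0 := by
  obtain ⟨k, hk, hkd⟩ := hS.degenerate p
  obtain ⟨r, rfl⟩ := hS.exists_smul hk (hkd k) hvv
  rw [map_smul, smul_apply, hkd, smul_zero]

lemma IsNullSurface.isDegenerateFieldAt (hS : g.IsNullSurface (d := d) ι) {U : Set S}
    {ℓ : ∀ p : S, TangentSpace (𝓡 d) p} (hℓ : g.IsNullField ι U ℓ) (hu : u ∈ chartDomain n d ι c p₀)
    (hU : (extChartAt (𝓡 d) p₀).symm u ∈ U) :
    IsDegenerateFieldAt (g.metricCoord c) (chartMap n d ι c p₀) (fieldCoord p₀ ℓ) u where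
  contDiffAt := contDiffAt_vecCoord hu.1 (hℓ.contMDiffOn.contMDiffAt (hℓ.isOpen.mem_nhds hU))
  orthogonal := by
    have h1 : ∀ᶠ v in 𝓝 u, (extChartAt (𝓡 d) p₀).symm v ∈ U :=
      (contMDiffAt_extChartAt_symm hu.1).continuousAt.eventually (hℓ.isOpen.mem_nhds hU)
    filter_upwards [h1, (isOpen_chartDomain hS.contMDiff.continuous c p₀).mem_nhds hu]
      with v hv hvd Y
    rw [g.metricCoord_chartMap hS.contMDiff hvd, matrixForm_formCoord, fieldCoord,
      coordLift_vecCoord hvd.1]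
    exact hS.induced_eq_zero (hℓ.null _ hv) _

lemma IsNullSurface.isLorentzImmersionAt (hS : g.IsNullSurface (d := d) ι)
    (hu : u ∈ chartDomain n d ι c p₀) :
    IsLorentzImmersionAt (g.connectionCoord c) (g.metricCoord c) (chartMap n d ι c p₀) u :=
  g.isLorentzImmersionAt_chartMap hS.contMDiff hS.injective_mfderiv hu

/-- The second fundamental form does not depend on the chart of `M`, since it is half the Lie
derivative of the induced metric. -/
lemma IsNullSurface.lieDerivative (hS : g.IsNullSurface (d := d) ι) {U : Set S}
    {ℓ : ∀ p : S, TangentSpace (𝓡 d) p} (hℓ : g.IsNullField ι U ℓ) (hu : u ∈ chartDomain n d ι c p₀)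
    (hU : (extChartAt (𝓡 d) p₀).symm u ∈ U) (X Y : EuclideanSpace ℝ (Fin d)) :
    2 * g.metricCoord c (chartMap n d ι c p₀ u) (covAlong (g.connectionCoord c)
        (chartMap n d ι c p₀)
        (fun u => fderiv ℝ (chartMap n d ι c p₀) u (fieldCoord p₀ ℓ u)) u X)
        (fderiv ℝ (chartMap n d ι c p₀) u Y)
      = fderiv ℝ (fun w => matrixForm (formCoord (g.induced ι) p₀) w X Y) u (fieldCoord p₀ ℓ u)
        + matrixForm (formCoord (g.induced ι) p₀) u (fderiv ℝ (fieldCoord p₀ ℓ) u X) Y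
        + matrixForm (formCoord (g.induced ι) p₀) u X (fderiv ℝ (fieldCoord p₀ ℓ) u Y) := by
  rw [← (hS.isDegenerateFieldAt hℓ hu hU).lieDerivative (hS.isLorentzImmersionAt hu),
    g.metricCoord_chartMap hS.contMDiff hu, g.metricCoord_chartMap hS.contMDiff hu]
  congr 3
  refine EventuallyEq.fderiv_eq ?_
  filter_upwards [(isOpen_chartDomain hS.contMDiff.continuous c p₀).mem_nhds hu] with v hv
  exact g.metricCoord_chartMap hS.contMDiff hv X Y

lemma IsNullSurface.differentiableAt_formCoord_induced (hS : g.IsNullSurface (d := d) ι)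
    (hu : u ∈ chartDomain n d ι c p₀) (i j : Fin d) :
    DifferentiableAt ℝ (fun u => formCoord (g.induced ι) p₀ u i j) u := by
  have h := hS.isLorentzImmersionAt hu
  have h1 : DifferentiableAt ℝ (fun u => g.metricCoord c (chartMap n d ι c p₀ u)
      (fderiv ℝ (chartMap n d ι c p₀) u (EuclideanSpace.single i 1))
      (fderiv ℝ (chartMap n d ι c p₀) u (EuclideanSpace.single j 1))) u :=
    ((h.differentiableAt_metric.comp u h.differentiableAt).clm_apply
      (h.differentiableAt_fderiv_apply contDiffAt_const)).clm_apply
      (h.differentiableAt_fderiv_apply contDiffAt_const)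
  refine h1.congr_of_eventuallyEq ?_
  filter_upwards [(isOpen_chartDomain hS.contMDiff.continuous c p₀).mem_nhds hu] with v hv
  rw [g.metricCoord_chartMap hS.contMDiff hv, matrixForm_formCoord]
  rfl

/-- The ambient chart is the one centred at `ι p`, as in the definition of `covDerivAlong`, so this
form cannot be used directly on a neighbourhood of `p`. -/
lemma IsNullSurface.derivTensor_eq_self (hS : g.IsNullSurface (d := d) ι) {U : Set S}
    {ℓ : ∀ p : S, TangentSpace (𝓡 d) p} (hℓ : g.IsNullField ι U ℓ) {p : S} (hpU : p ∈ U)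
    (hp : p ∈ (extChartAt (𝓡 d) p₀).source) (X Y : TangentSpace (𝓡 d) p) :
    g.derivTensor ι ℓ p X Y
      = g.metricCoord (ι p) (chartMap n d ι (ι p) p₀ (extChartAt (𝓡 d) p₀ p))
        (covAlong (g.connectionCoord (ι p)) (chartMap n d ι (ι p) p₀)
          (fun u => fderiv ℝ (chartMap n d ι (ι p) p₀) u (fieldCoord p₀ ℓ u))
          (extChartAt (𝓡 d) p₀ p) (vecCoord p₀ p X))
        (fderiv ℝ (chartMap n d ι (ι p) p₀) (extChartAt (𝓡 d) p₀ p) (vecCoord p₀ p Y)) := by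
  have hM : IsManifold (𝓡 n) 1 M := IsManifold.of_le (n := ∞) (by simp)
  have hSm : IsManifold (𝓡 d) 1 S := IsManifold.of_le (n := ∞) (by simp)
  have hc : ι p ∈ (extChartAt (𝓡 n) (ι p)).source := mem_extChartAt_source _
  have hu := mem_chartDomain hp hc
  have hU : (extChartAt (𝓡 d) p₀).symm (extChartAt (𝓡 d) p₀ p) ∈ U := by
    rwa [(extChartAt (𝓡 d) p₀).left_inv hp]
  have hL := hS.isDegenerateFieldAt hℓ hu hU
  have hF := hS.isLorentzImmersionAt hu
  have hFp : chartMap n d ι (ι p) p₀ (extChartAt (𝓡 d) p₀ p) = extChartAt (𝓡 n) (ι p) (ι p) := by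
    rw [chartMap, (extChartAt (𝓡 d) p₀).left_inv hp]
  rw [derivTensor, ← matrixForm_formCoord_vecCoord g.val hc,
    ← fderiv_chartMap_vecCoord hS.contMDiff hp hc, hFp]
  congr 2
  have hinv := isInvertible_mfderiv_extChartAt (I := 𝓡 n) hc
  set Vc : S → EuclideanSpace ℝ (Fin n) := fun p' =>
    vecCoord (ι p) (ι p') (mfderiv (𝓡 d) (𝓡 n) ι p' (ℓ p')) with hVc
  have hVp : Vc p = fderiv ℝ (chartMap n d ι (ι p) p₀) (extChartAt (𝓡 d) p₀ p)
      (fieldCoord p₀ ℓ (extChartAt (𝓡 d) p₀ p)) := by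
    rw [fieldCoord_extChartAt hp, fderiv_chartMap_vecCoord hS.contMDiff hp hc]
  have hV : Vc =ᶠ[𝓝 p] (fun u => fderiv ℝ (chartMap n d ι (ι p) p₀) u (fieldCoord p₀ ℓ u))
      ∘ extChartAt (𝓡 d) p₀ := by
    filter_upwards [(isOpen_extChartAt_source (I := 𝓡 d) p₀).mem_nhds hp,
      ((isOpen_extChartAt_source (I := 𝓡 n) (ι p)).preimage hS.contMDiff.continuous).mem_nhds hc]
      with q hq hqc
    rw [Function.comp_apply, fieldCoord_extChartAt hq, fderiv_chartMap_vecCoord hS.contMDiff hq hqc]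
  have hdV : (mfderiv (𝓡 d) 𝓘(ℝ, EuclideanSpace ℝ (Fin n)) Vc p X : EuclideanSpace ℝ (Fin n))
      = fderiv ℝ (fun u => fderiv ℝ (chartMap n d ι (ι p) p₀) u (fieldCoord p₀ ℓ u))
        (extChartAt (𝓡 d) p₀ p) (vecCoord p₀ p X) := by
    have h1 := (hF.differentiableAt_fderiv_apply hL.contDiffAt).hasFDerivAt.hasMFDerivAt
    have h2 : MDifferentiableAt (𝓡 d) 𝓘(ℝ, EuclideanSpace ℝ (Fin d)) (extChartAt (𝓡 d) p₀) p :=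
      mdifferentiableAt_extChartAt (by rwa [← extChartAt_source (I := 𝓡 d)])
    have h3 := ((h1.comp p h2.hasMFDerivAt).congr_of_eventuallyEq hV).mfderiv
    exact DFunLike.congr_fun h3 X
  have hD : ∀ D : EuclideanSpace ℝ (Fin n), vecCoord (ι p) (ι p)
      ((mfderiv (𝓡 n) 𝓘(ℝ, EuclideanSpace ℝ (Fin n)) (extChartAt (𝓡 n) (ι p)) (ι p)).inverse D)
      = D := fun D => DFunLike.congr_fun hinv.self_comp_inverse D
  refine (hD _).trans ?_
  ext k
  rw [covAlong, PiLp.add_apply, connectionCoord, christoffelForm_apply, hFp,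
    fderiv_chartMap_vecCoord hS.contMDiff hp hc, ← hdV, ← hVp]

/-- The tensor `∇_a ℓ_b` in charts. -/
lemma IsNullSurface.derivTensor_eq (hS : g.IsNullSurface (d := d) ι) {U : Set S}
    {ℓ : ∀ p : S, TangentSpace (𝓡 d) p} (hℓ : g.IsNullField ι U ℓ) {p : S} (hpU : p ∈ U)
    (hp : p ∈ (extChartAt (𝓡 d) p₀).source) (hc : ι p ∈ (extChartAt (𝓡 n) c).source)
    (X Y : TangentSpace (𝓡 d) p) :
    g.derivTensor ι ℓ p X Y
      = g.metricCoord c (chartMap n d ι c p₀ (extChartAt (𝓡 d) p₀ p))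
        (covAlong (g.connectionCoord c) (chartMap n d ι c p₀)
          (fun u => fderiv ℝ (chartMap n d ι c p₀) u (fieldCoord p₀ ℓ u))
          (extChartAt (𝓡 d) p₀ p) (vecCoord p₀ p X))
        (fderiv ℝ (chartMap n d ι c p₀) (extChartAt (𝓡 d) p₀ p) (vecCoord p₀ p Y)) := by
  have hU : (extChartAt (𝓡 d) p₀).symm (extChartAt (𝓡 d) p₀ p) ∈ U := by
    rwa [(extChartAt (𝓡 d) p₀).left_inv hp]
  -- The Lie derivative formula in the charts `c` and `ι p` has the same right-hand side, so the
  -- covariant expressions agree without any transformation law for Christoffel symbols.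
  have h1 := hS.lieDerivative hℓ (mem_chartDomain hp hc) hU (vecCoord p₀ p X) (vecCoord p₀ p Y)
  have h2 := hS.lieDerivative hℓ (mem_chartDomain hp (mem_extChartAt_source (I := 𝓡 n) (ι p))) hU
    (vecCoord p₀ p X) (vecCoord p₀ p Y)
  rw [hS.derivTensor_eq_self hℓ hpU hp]
  linarith

/-- The pullback of `∇_a ℓ_b` depends linearly on the value of the null field `ℓ` at the point. -/
lemma IsNullSurface.derivTensor_eq_mul (hS : g.IsNullSurface (d := d) ι) {U U' : Set S}
    {ℓ ℓ' : ∀ p : S, TangentSpace (𝓡 d) p} (hℓ : g.IsNullField ι U ℓ)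
    (hℓ' : g.IsNullField ι U' ℓ') {p : S} (hpU : p ∈ U) (hpU' : p ∈ U') {r : ℝ}
    (hr : ℓ' p = r • ℓ p) (X Y : TangentSpace (𝓡 d) p) :
    g.derivTensor ι ℓ' p X Y = r * g.derivTensor ι ℓ p X Y := by
  have hp : p ∈ (extChartAt (𝓡 d) p).source := mem_extChartAt_source _
  have hc : ι p ∈ (extChartAt (𝓡 n) (ι p)).source := mem_extChartAt_source _
  have hu := mem_chartDomain hp hc
  have hU : (extChartAt (𝓡 d) p).symm (extChartAt (𝓡 d) p p) ∈ U := by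
    rwa [(extChartAt (𝓡 d) p).left_inv hp]
  have hU' : (extChartAt (𝓡 d) p).symm (extChartAt (𝓡 d) p p) ∈ U' := by
    rwa [(extChartAt (𝓡 d) p).left_inv hp]
  have hF := hS.isLorentzImmersionAt hu
  rw [hS.derivTensor_eq hℓ hpU hp hc, hS.derivTensor_eq hℓ' hpU' hp hc,
    (hS.isDegenerateFieldAt hℓ hu hU).metric_covAlong hF,
    (hS.isDegenerateFieldAt hℓ' hu hU').metric_covAlong hF,
    fieldCoord_extChartAt hp, fieldCoord_extChartAt hp, hr, vecCoord_smul, map_smul, map_smul,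
    smul_apply, smul_eq_mul]
  ring

/-- `ℒ_ℓ q` is twice the pullback of `∇_a ℓ_b`. -/
lemma IsNullSurface.lieDerivForm_eq (hS : g.IsNullSurface (d := d) ι) {U : Set S}
    {ℓ : ∀ p : S, TangentSpace (𝓡 d) p} (hℓ : g.IsNullField ι U ℓ) {p : S} (hpU : p ∈ U)
    (X Y : TangentSpace (𝓡 d) p) :
    lieDerivForm (g.induced ι) ℓ p X Y = 2 * g.derivTensor ι ℓ p X Y := by
  have hp : p ∈ (extChartAt (𝓡 d) p).source := mem_extChartAt_source _
  have hc : ι p ∈ (extChartAt (𝓡 n) (ι p)).source := mem_extChartAt_source _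
  have hu := mem_chartDomain hp hc
  have hU : (extChartAt (𝓡 d) p).symm (extChartAt (𝓡 d) p p) ∈ U := by
    rwa [(extChartAt (𝓡 d) p).left_inv hp]
  rw [hS.derivTensor_eq hℓ hpU hp hc, hS.lieDerivative hℓ hu hU]
  exact sum_lieDerivative_eq (hS.differentiableAt_formCoord_induced hu)
    ((hS.isDegenerateFieldAt hℓ hu hU).contDiffAt.differentiableAt (by simp)) _ _

end LorentzMetric

end Derivative

/-! ### Expansion, Ricci curvature, and vanishing of the shear. -/

section NonExpanding

open Filter Topology

set_option maxSynthPendingDepth 3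

variable {n d : ℕ} {M : Type*} [TopologicalSpace M] [ChartedSpace (EuclideanSpace ℝ (Fin n)) M]
  [IsManifold (𝓡 n) ∞ M] {S : Type*} [TopologicalSpace S]
  [ChartedSpace (EuclideanSpace ℝ (Fin d)) S] [IsManifold (𝓡 d) ∞ S]

/-- The linear equivalence between tangent vectors and their components. -/
noncomputable def vecCoordEquiv (c : S) {u : EuclideanSpace ℝ (Fin d)}
    (hu : u ∈ (extChartAt (𝓡 d) c).target) :
    TangentSpace (𝓡 d) ((extChartAt (𝓡 d) c).symm u) ≃ₗ[ℝ] EuclideanSpace ℝ (Fin d) where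
  toFun := vecCoord c ((extChartAt (𝓡 d) c).symm u)
  map_add' v w := map_add (mfderiv (𝓡 d) 𝓘(ℝ, EuclideanSpace ℝ (Fin d)) (extChartAt (𝓡 d) c)
    ((extChartAt (𝓡 d) c).symm u)) v w
  map_smul' r v := vecCoord_smul c _ r v
  invFun := coordLift c u
  left_inv := coordLift_vecCoord hu
  right_inv := vecCoord_coordLift hu

namespace LorentzMetric

variable {g : LorentzMetric n M} {ι : S → M} {c : M} {p₀ : S} {u : EuclideanSpace ℝ (Fin d)}

/-- The expansion is the trace of the Weingarten map minus its eigenvalue on the null direction. -/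
lemma IsNullSurface.expansion_eq (hS : g.IsNullSurface (d := d) ι)
    {ℓ : ∀ p : S, TangentSpace (𝓡 d) p} {p : S} (hℓ : ℓ p ≠ 0)
    (hnull : g.induced ι p (ℓ p) (ℓ p) = 0) (W : TangentSpace (𝓡 d) p →ₗ[ℝ] TangentSpace (𝓡 d) p)
    (hW : ∀ X Y, g.derivTensor ι ℓ p X Y = g.induced ι p (W X) Y) {κ : ℝ}
    (hκ : W (ℓ p) = κ • ℓ p) :
    g.expansion ι ℓ p = LinearMap.trace ℝ _ W - κ := by
  have : FiniteDimensional ℝ (TangentSpace (𝓡 d) p) :=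
    inferInstanceAs (FiniteDimensional ℝ (EuclideanSpace ℝ (Fin d)))
  have hN : ∀ x, x ∈ g.nullDirection (d := d) ι p ↔ ∀ y, g.induced ι p x y = 0 := fun x =>
    ContinuousLinearMap.ext_iff
  -- The degeneracy subspace is the eigenline of `W` through `ℓ p`, so the quotient trace defining
  -- the expansion is the full trace minus `κ`.
  have hspan : g.nullDirection (d := d) ι p = Submodule.span ℝ {ℓ p} := by
    refine le_antisymm (fun x hx => ?_) ?_
    · obtain ⟨r, rfl⟩ := hS.exists_smul hℓ hnull ((hN x).1 hx x)
      exact Submodule.smul_mem _ _ (Submodule.mem_span_singleton_self _)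
    · rw [Submodule.span_singleton_le_iff_mem, hN]
      exact hS.induced_eq_zero hnull
  have hcomap : g.nullDirection (d := d) ι p ≤ (g.nullDirection (d := d) ι p).comap W := by
    nth_rewrite 1 [hspan]
    rw [Submodule.span_singleton_le_iff_mem, Submodule.mem_comap, hκ, hspan]
    exact Submodule.smul_mem _ _ (Submodule.mem_span_singleton_self _)
  obtain ⟨φ, hφ⟩ : ∃ φ : TangentSpace (𝓡 d) p →ₗ[ℝ] ℝ, φ (ℓ p) = 1 := by
    obtain ⟨ψ, hψ⟩ := not_forall.1 (mt (Module.forall_dual_apply_eq_zero_iff ℝ (ℓ p)).1 hℓ)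
    exact ⟨(ψ (ℓ p))⁻¹ • ψ, inv_mul_cancel₀ hψ⟩
  rw [trace_eq_add_trace_mapQ_span W hφ hκ _ hspan hcomap, add_sub_cancel_left,
    ← sum_inv_mul_eq_trace_mapQ (bilinForm (g.induced ι p)) (fun x y => g.symm _ _ _) _ hN W hcomap
      (finBasis ℝ (TangentSpace (𝓡 d) p ⧸ g.nullDirection (d := d) ι p))
      (g.screenBasis (d := d) ι p) (fun A => Quotient.out_eq _)]
  simp only [expansion, hW]
  rfl

/-- The field supplied by non-expansion may change with the point, but any null field is a multiple
of it there and the expansion scales by the same factor. Hence one fixed field has zero expansion on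
its whole domain, so this vanishing may be differentiated. -/
lemma IsNullSurface.expansion_eq_zero (hS : g.IsNullSurface (d := d) ι)
    (hexp : g.IsNonExpanding (d := d) ι) {U : Set S} {ℓ : ∀ p : S, TangentSpace (𝓡 d) p}
    (hℓ : g.IsNullField ι U ℓ) {p : S} (hp : p ∈ U) : g.expansion ι ℓ p = 0 := by
  obtain ⟨U', ℓ', hℓ', hp', h0, hθ⟩ := hexp p
  obtain ⟨r, hr⟩ := hS.exists_smul h0 (hℓ'.null p hp') (hℓ.null p hp)
  simp only [expansion, hS.derivTensor_eq_mul hℓ' hℓ hp' hp hr] at hθ ⊢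
  rw [← mul_zero r, ← hθ, Finset.mul_sum]
  refine Finset.sum_congr rfl fun A _ => ?_
  rw [Finset.mul_sum]
  exact Finset.sum_congr rfl fun B _ => by ring

lemma ricci_smul_self (g : LorentzMetric n M) (x : M) (r : ℝ) (v : TangentSpace (𝓡 n) x) :
    g.ricci x (r • v) (r • v) = r ^ 2 * g.ricci x v v := by
  simp only [ricci, vecCoord_smul, PiLp.smul_apply, smul_eq_mul, Finset.mul_sum]
  exact Finset.sum_congr rfl fun _ _ => Finset.sum_congr rfl fun _ _ => by ring

/-- The map `z ↦ R(z, v) v`, whose trace is `Ric(v, v)`. -/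
noncomputable def tidalMap {E : Type*} [NormedAddCommGroup E] [NormedSpace ℝ E]
    (Γ : E → E →L[ℝ] E →L[ℝ] E) (x v : E) : E →ₗ[ℝ] E where
  toFun z := curvatureForm Γ x z v v
  map_add' z w := by
    simp only [curvatureForm, map_add, add_apply]
    abel
  map_smul' r z := by
    simp only [curvatureForm, map_smul, smul_apply, RingHom.id_apply, smul_add, smul_sub]

lemma ricci_eq_trace (g : LorentzMetric n M) (x : M) (v : TangentSpace (𝓡 n) x) :
    g.ricci x v v = LinearMap.trace ℝ (EuclideanSpace ℝ (Fin n))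
      (tidalMap (g.connectionCoord x) (extChartAt (𝓡 n) x x) (vecCoord x x v)) := by
  have hx := mem_extChartAt_target (I := 𝓡 n) x
  refine sum_ricciCoord_eq_trace (fun k i j => ?_) _ _ fun z => rfl
  exact (contDiffAt_christoffel (k := ∞) (fun i j => contDiffAt_formCoord g.contMDiff hx i j)
    (by simp) (g.det_formCoord_ne_zero hx) k i j).differentiableAt (by simp)

/-- A non-expanding null hypersurface satisfying the null energy condition is shear free. -/
lemma IsNullSurface.shear_free (hnd : n = d + 1) (hS : g.IsNullSurface (d := d) ι)
    (hexp : g.IsNonExpanding (d := d) ι) {U : Set S} {ℓ : ∀ p : S, TangentSpace (𝓡 d) p}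
    (hℓ : g.IsNullField ι U ℓ) {p : S} (hp : p ∈ U) (h0 : ℓ p ≠ 0)
    (hRic : 0 ≤ g.ricci (ι p) (mfderiv (𝓡 d) (𝓡 n) ι p (ℓ p))
      (mfderiv (𝓡 d) (𝓡 n) ι p (ℓ p))) :
    (∀ X Y, g.derivTensor ι ℓ p X Y = 0) ∧
      g.ricci (ι p) (mfderiv (𝓡 d) (𝓡 n) ι p (ℓ p)) (mfderiv (𝓡 d) (𝓡 n) ι p (ℓ p)) = 0 := by
  have hps : p ∈ (extChartAt (𝓡 d) p).source := mem_extChartAt_source _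
  have hc : ι p ∈ (extChartAt (𝓡 n) (ι p)).source := mem_extChartAt_source _
  have hu := mem_chartDomain hps hc
  set F := chartMap n d ι (ι p) p with hF
  set u := extChartAt (𝓡 d) p p with hudef
  have hup : (extChartAt (𝓡 d) p).symm u = p := (extChartAt (𝓡 d) p).left_inv hps
  have hdom : ∀ᶠ v in 𝓝 u, v ∈ chartDomain n d ι (ι p) p :=
    (isOpen_chartDomain hS.contMDiff.continuous _ _).mem_nhds hu
  have hUev : ∀ᶠ v in 𝓝 u, (extChartAt (𝓡 d) p).symm v ∈ U :=
    (contMDiffAt_extChartAt_symm hu.1).continuousAt.eventually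
      (hℓ.isOpen.mem_nhds (by rwa [hup]))
  have himm : ∀ᶠ v in 𝓝 u, IsLorentzImmersionAt (g.connectionCoord (ι p)) (g.metricCoord (ι p)) F v :=
    hdom.mono fun v hv => hS.isLorentzImmersionAt hv
  have hdeg : ∀ᶠ v in 𝓝 u, IsDegenerateFieldAt (g.metricCoord (ι p)) F (fieldCoord p ℓ) v := by
    filter_upwards [hdom, hUev] with v hv hvU
    exact hS.isDegenerateFieldAt hℓ hv hvU
  have hL0 : fieldCoord p ℓ u ≠ 0 := by
    rw [hudef, fieldCoord_extChartAt hps, Ne, vecCoord_eq_zero_iff hps]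
    exact h0
  have hdim : finrank ℝ (EuclideanSpace ℝ (Fin n)) = finrank ℝ (EuclideanSpace ℝ (Fin d)) + 1 := by
    rw [finrank_euclideanSpace_fin, finrank_euclideanSpace_fin, hnd]
  obtain ⟨W, κ, hWs, hκs, hW, hWL⟩ := exists_weingarten hdim himm hdeg hL0
  have hL0ev : ∀ᶠ v in 𝓝 u, fieldCoord p ℓ v ≠ 0 :=
    hdeg.self_of_nhds.contDiffAt.continuousAt.eventually_ne hL0
  -- At each nearby point `W v` is conjugated by the chart isomorphism to an endomorphism of the
  -- tangent space there, where `expansion_eq` applies. The ambient chart remains the one at `ι p`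
  -- although the point moves.
  have hθ : ∀ᶠ v in 𝓝 u, LinearMap.trace ℝ _ (W v : EuclideanSpace ℝ (Fin d) →ₗ[ℝ] _) = κ v := by
    filter_upwards [hdom, hUev, hW, hWL, hL0ev] with v hv hvU hWv hWLv hv0
    let A := vecCoordEquiv p hv.1
    have hvs := (extChartAt (𝓡 d) p).map_target hv.1
    have hvr := (extChartAt (𝓡 d) p).right_inv hv.1
    have hne : ℓ ((extChartAt (𝓡 d) p).symm v) ≠ 0 := fun h => hv0 (by
      rw [fieldCoord, h]
      exact map_zero A)
    have h1 := hS.expansion_eq hne (hℓ.null _ hvU) (A.symm.conj (W v : EuclideanSpace ℝ (Fin d) →ₗ[ℝ] _))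
      (fun X Y => by
        rw [hS.derivTensor_eq hℓ hvU hvs hv.2, hvr, ← hF, hWv,
          ← g.metricCoord_chartMap_vecCoord hS.contMDiff hvs hv.2, hvr, ← hF]
        congr 3
        exact (A.apply_symm_apply _).symm) (κ := κ v)
      (by
        apply A.injective
        rw [map_smul]
        exact (A.apply_symm_apply _).trans hWLv)
    rw [hS.expansion_eq_zero hexp hℓ hvU, LinearMap.trace_conj'] at h1
    linarith
  have hVu : fderiv ℝ F u (fieldCoord p ℓ u)
      = vecCoord (ι p) (ι p) (mfderiv (𝓡 d) (𝓡 n) ι p (ℓ p)) := by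
    rw [hudef, fieldCoord_extChartAt hps, hF, fderiv_chartMap_vecCoord hS.contMDiff hps hc]
  have hFu : F u = extChartAt (𝓡 n) (ι p) (ι p) := by rw [hF, chartMap, hup]
  have key := trace_curvature_nonpos hdim himm hdeg hL0 hWs hκs hW hWL hθ
    (tidalMap (g.connectionCoord (ι p)) (F u) (fderiv ℝ F u (fieldCoord p ℓ u))) fun z => rfl
  rw [hVu, hFu, ← g.ricci_eq_trace] at key
  -- Raychaudhuri's equation bounds the Ricci term above by zero, the energy condition bounds it
  -- below.
  have hz := le_antisymm key.1 hRic
  refine ⟨fun X Y => ?_, hz⟩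
  rw [hS.derivTensor_eq hℓ hp hps hc, ← hudef, ← hF, hFu]
  exact key.2 hz _ _

end LorentzMetric

end NonExpanding
-- The main theorem.
theorem theorem1 {n : ℕ} (hn : 2 < n)
    {M : Type*} [TopologicalSpace M] [ChartedSpace (EuclideanSpace ℝ (Fin n)) M]
    [IsManifold (𝓡 n) ∞ M] (g : LorentzMetric n M)
    {S : Type*} [TopologicalSpace S] [ChartedSpace (EuclideanSpace ℝ (Fin (n - 1))) S]
    [IsManifold (𝓡 (n - 1)) ∞ S] (ι : S → M)
    (hnull : g.IsNullSurface (d := n - 1) ι)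
    (hexp : g.IsNonExpanding (d := n - 1) ι)
    (Λ : ℝ) (T : ∀ x : M, TangentSpace (𝓡 n) x →L[ℝ] TangentSpace (𝓡 n) x →L[ℝ] ℝ)
    (hEinstein : ∀ (p : S) (v w : TangentSpace (𝓡 n) (ι p)),
      g.einstein (ι p) v w = -Λ * g.val (ι p) v w + T (ι p) v w)
    (henergy : ∀ (p : S) (v : TangentSpace (𝓡 (n - 1)) p), g.induced ι p v v = 0 →
      0 ≤ T (ι p) (mfderiv (𝓡 (n - 1)) (𝓡 n) ι p v) (mfderiv (𝓡 (n - 1)) (𝓡 n) ι p v)) :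
    (∀ (U : Set S) (ℓ : ∀ p : S, TangentSpace (𝓡 (n - 1)) p), g.IsNullField ι U ℓ →
      ∀ p ∈ U, ∀ X Y : TangentSpace (𝓡 (n - 1)) p, g.derivTensor ι ℓ p X Y = 0) ∧
    (∀ (U : Set S) (ℓ : ∀ p : S, TangentSpace (𝓡 (n - 1)) p), g.IsNullField ι U ℓ →
      ∀ p ∈ U, ∀ X Y : TangentSpace (𝓡 (n - 1)) p,
        lieDerivForm (g.induced ι) ℓ p X Y = 0) ∧
    (∀ (p : S) (v : TangentSpace (𝓡 (n - 1)) p), g.induced ι p v v = 0 →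
      g.ricci (ι p) (mfderiv (𝓡 (n - 1)) (𝓡 n) ι p v)
        (mfderiv (𝓡 (n - 1)) (𝓡 n) ι p v) = 0) := by
  have hnd : n = n - 1 + 1 := by omega
  have hric : ∀ (p : S) (v : TangentSpace (𝓡 (n - 1)) p), g.induced ι p v v = 0 →
      0 ≤ g.ricci (ι p) (mfderiv (𝓡 (n - 1)) (𝓡 n) ι p v)
        (mfderiv (𝓡 (n - 1)) (𝓡 n) ι p v) := by
    intro p v hv
    have h1 := hEinstein p (mfderiv (𝓡 (n - 1)) (𝓡 n) ι p v) (mfderiv (𝓡 (n - 1)) (𝓡 n) ι p v)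
    have h2 := henergy p v hv
    rw [LorentzMetric.induced_apply] at hv
    -- On a null vector the scalar curvature and cosmological terms carry a factor `g(v, v) = 0`, so
    -- the Ricci term equals the energy term.
    rw [LorentzMetric.einstein, hv] at h1
    linarith
  have hshear : ∀ (U : Set S) (ℓ : ∀ p : S, TangentSpace (𝓡 (n - 1)) p), g.IsNullField ι U ℓ →
      ∀ p ∈ U, ∀ X Y : TangentSpace (𝓡 (n - 1)) p, g.derivTensor ι ℓ p X Y = 0 := by
    intro U ℓ hℓ p hp X Y
    -- The field `ℓ` may vanish at `p`, so the argument runs with the field `ℓ'`, nonzero there, and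
    -- is carried over by `ℓ p = r • ℓ' p`, where `r` may be zero.
    obtain ⟨U', ℓ', hℓ', hp', h0, -⟩ := hexp p
    obtain ⟨r, hr⟩ := hnull.exists_smul h0 (hℓ'.null p hp') (hℓ.null p hp)
    rw [hnull.derivTensor_eq_mul hℓ' hℓ hp' hp hr,
      (hnull.shear_free hnd hexp hℓ' hp' h0 (hric p _ (hℓ'.null p hp'))).1, mul_zero]
  refine ⟨hshear, fun U ℓ hℓ p hp X Y => ?_, fun p v hv => ?_⟩
  · rw [hnull.lieDerivForm_eq hℓ hp, hshear U ℓ hℓ p hp, mul_zero]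
  · obtain ⟨U', ℓ', hℓ', hp', h0, -⟩ := hexp p
    obtain ⟨r, rfl⟩ := hnull.exists_smul h0 (hℓ'.null p hp') hv
    rw [map_smul, g.ricci_smul_self,
      (hnull.shear_free hnd hexp hℓ' hp' h0 (hric p _ (hℓ'.null p hp'))).2, mul_zero]
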